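/- Let $W$ be the set of functions $\phi(x)=\int_{\mathbb R}e^{ixy}\,d\mu(y)$, $x\in\mathbb R$, with $\mu$ a complex Borel measure on $\mathbb R$ of finite total variation, and put $\|\phi\|_W=\operatorname{var}\mu$. Let $W^+\subset W$ be the set of those $\phi$ for which $\mu$ is positive (the positive definite functions in $W$), and let $W_0\subset W$ be the set of functions $\phi(x)=\int_{\mathbb R}e^{ixy}g(y)\,dy$ with $g\in L_1(\mathbb R)$. Let $\mathbb T=[-\pi,\pi)$. A function of bounded variation on $\mathbb T$ is a function $F:\mathbb R\to\mathbb C$ that is of bounded variation on bounded intervals, for which $F(t+2\pi)-F(t)$ is constant, and which is normalized at its jumps so that $F(t)$ lies on the segment between $F(t-)$ and $F(t+)$ for every $t$. Let $V(F)$ be its total variation over the period $[-\pi,\pi]$, and let $dF$ be the associated Stieltjes measure on $\mathbb T$. We say that $\sum_{k\in\mathbb Z}c_ke^{ikt}$ is the Fourier–Stieltjes series of $dF$ if $c_k=\int_{\mathbb T}e^{-ikt}\,dF(t)$ for all $k\in\mathbb Z$ (the usual factor $\frac1{2\pi}$ is absorbed in $F$), and that it is a Fourier series if $c_k=\frac1{2\pi}\int_{\mathbb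 T}f(t)e^{-ikt}\,dt$ for all $k\in\mathbb Z$, for some $f\in L_1(\mathbb T)$. **Theorem.** Let $(c_k)_{k\in\mathbb Z}$ be a sequence of complex numbers. 1. The series $\sum c_ke^{ikt}$ is the Fourier–Stieltjes series of $dF$ for some $F$ of bounded variation on $\mathbb T$ if and only if there is $\phi\in W$ with $\phi(k)=c_k$ for all $k\in\mathbb Z$. It is a Fourier series if and only if there is $\phi\in W_0$ with $\phi(k)=c_k$ for all $k\in\mathbb Z$. Suppose now that $\sum c_ke^{ikt}$ is the Fourier–Stieltjes series of $dF$, and let $\phi_0(x)=\int_{\mathbb T}e^{-ixt}\,dF(t)$, $x\in\mathbb R$. 2. $V(F)=\min\|\phi\|_W$, where the minimum is taken over all $\phi\in W$ with $\phi(k)=c_k$ for all $k\in\mathbb Z$, and it is attained at $\phi_0$. If the series is a Fourier series, then $\phi_0\in W_0$, so that the minimum is also the minimum over all such $\phi\in W_0$. 3. The functions $\phi\in W$ with $\phi(k)=c_k$ for all $k\in\mathbb Z$ that are restrictions to $\mathbb R$ of entire functions of exponential type not exceeding $\pi$ are exactly the functions $\phi_0(x)+\lambda\sin\pi x$ with $\lambda\in\mathbb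 C$. 4. $F$ is increasing (that is, $F(t)-F(s)$ is real and $\ge0$ whenever $s\le t$) if and only if there is $\phi\in W^+$ with $\phi(k)=c_k$ for all $k\in\mathbb Z$. -/

import Mathlib

open MeasureTheory Set Real

namespace WienerSeries

noncomputable section

/-- The Fourier–Stieltjes integral `x ↦ ∫ e^{ixy} dμ(y)` of a complex Borel measure on `ℝ`. -/
def fourierStieltjes (μ : ComplexMeasure ℝ) (x : ℝ) : ℂ :=
  μ.integral (fun y : ℝ => Complex.exp (Complex.I * x * y)) (ContinuousLinearMap.mul ℝ ℂ)

/-- `μ` is a complex Borel measure of finite total variation with `φ(x) = ∫ e^{ixy} dμ(y)`. -/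
def Represents (μ : ComplexMeasure ℝ) (φ : ℝ → ℂ) : Prop :=
  μ.variation univ < ⊤ ∧ ∀ x, φ x = fourierStieltjes μ x

/-- The algebra `W` of Fourier transforms of complex measures of finite variation. -/
def W : Set (ℝ → ℂ) := {φ | ∃ μ : ComplexMeasure ℝ, Represents μ φ}

/-- The norm of `φ ∈ W`: the total variation of the representing measure. The representing
measure is unique, so the infimum is over a single value; it gives a name to that value. -/
def wNorm (φ : ℝ → ℂ) : ℝ :=
  sInf {r : ℝ | ∃ μ : ComplexMeasure ℝ, Represents μ φ ∧ r = (μ.variation univ).toReal}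

/-- The algebra `W₀` of Fourier transforms of Lebesgue integrable functions. -/
def W₀ : Set (ℝ → ℂ) :=
  {φ | ∃ g : ℝ → ℂ, Integrable g ∧ ∀ x : ℝ, φ x = ∫ y : ℝ, Complex.exp (Complex.I * x * y) * g y}

/-- The class `W⁺` of Fourier transforms of finite positive measures
(the positive definite functions in `W`). -/
def WPos : Set (ℝ → ℂ) :=
  {φ | ∃ μ : Measure ℝ, IsFiniteMeasure μ ∧
    ∀ x : ℝ, φ x = ∫ y : ℝ, Complex.exp (Complex.I * x * y) ∂μ}

/-- Functions of bounded variation on the circle `𝕋 = [-π, π)`: functions `F` on the line whose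
increments are `2π`-periodic, of bounded variation on bounded intervals, and with the usual
normalization at jumps, namely that `F t` lies on the segment between `F (t-)` and `F (t+)` (for
example `F` left continuous, right continuous, equal to the mean of its one-sided limits, or
monotone). -/
structure IsBVCircle (F : ℝ → ℂ) : Prop where
  locallyBV : LocallyBoundedVariationOn F univ
  periodic_increment : ∃ m : ℂ, ∀ t, F (t + 2 * π) = F t + m
  normalized : ∀ t, F t ∈ segment ℝ (Function.leftLim F t) (Function.rightLim F t)

/-- `F` on `[-2π, 2π]`, continued by constants. -/
def clamp (F : ℝ → ℂ) (t : ℝ) : ℂ := F (max (-(2 * π)) (min t (2 * π)))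

theorem IsBVCircle.boundedVariationOn_clamp {F : ℝ → ℂ} (hF : IsBVCircle F) :
    BoundedVariationOn (clamp F) univ := by
  have h0 : -(2 * π) ≤ 2 * π := by linarith [Real.pi_pos]
  have h := hF.locallyBV (-(2 * π)) (2 * π) (mem_univ _) (mem_univ _)
  refine ne_top_of_le_ne_top h ?_
  refine eVariationOn.comp_le_of_monotoneOn F (t := univ)
    (fun t : ℝ => max (-(2 * π)) (min t (2 * π))) ?_ ?_
  · intro s _ t _ hst
    exact max_le_max le_rfl (min_le_min hst le_rfl)
  · intro t _
    exact ⟨mem_univ _, le_max_left _ _, max_le h0 (min_le_right _ _)⟩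

/-- The Stieltjes measure `dF` on `𝕋 = [-π, π)`, seen as a measure on the line: it gives mass
`F (b-) - F (a-)` to `[a, b)` when `-π ≤ a ≤ b ≤ π`. -/
def dStieltjes {F : ℝ → ℂ} (hF : IsBVCircle F) : ComplexMeasure ℝ :=
  hF.boundedVariationOn_clamp.vectorMeasure.restrict (Ico (-π) π)

/-- `x ↦ ∫_𝕋 e^{-ixt} dF(t)`. -/
def phi₀ {F : ℝ → ℂ} (hF : IsBVCircle F) (x : ℝ) : ℂ :=
  (dStieltjes hF).integral (fun t : ℝ => Complex.exp (-(Complex.I * x * t)))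
    (ContinuousLinearMap.mul ℝ ℂ)

/-- `∑ c_k e^{ikt}` is the Fourier–Stieltjes series of `dF`, normalized as
`c_k = ∫_𝕋 e^{-ikt} dF(t)`. -/
def IsFourierStieltjesSeries (c : ℤ → ℂ) {F : ℝ → ℂ} (hF : IsBVCircle F) : Prop :=
  ∀ k : ℤ, c k = (dStieltjes hF).integral
    (fun t : ℝ => Complex.exp (-(Complex.I * k * t))) (ContinuousLinearMap.mul ℝ ℂ)

/-- The total variation `V(F)` of `F` over a period. -/
def totalVar (F : ℝ → ℂ) : ℝ := (eVariationOn F (Icc (-π) π)).toReal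

/-- `∑ c_k e^{ikt}` is the Fourier series of an integrable function on `𝕋`. -/
def IsFourierSeries (c : ℤ → ℂ) : Prop :=
  ∃ f : ℝ → ℂ, IntegrableOn f (Ico (-π) π) ∧
    ∀ k : ℤ, c k = (1 / (2 * π)) * ∫ t in Ico (-π) π, f t * Complex.exp (-(Complex.I * k * t))

/-- `φ` takes the value `c_k` at each integer `k`. -/
def Extends (φ : ℝ → ℂ) (c : ℤ → ℂ) : Prop := ∀ k : ℤ, φ k = c k

/-- Entire functions of exponential type at most `σ`. -/
def IsEntireOfExpType (σ : ℝ) (g : ℂ → ℂ) : Prop :=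
  Differentiable ℂ g ∧ ∀ ε > 0, ∃ C : ℝ, ∀ z : ℂ, ‖g z‖ ≤ C * Real.exp ((σ + ε) * ‖z‖)

/-- All increments of `F` are nonnegative real numbers, that is, `F` is a (weakly) increasing real
function up to an additive complex constant. -/
def IsIncreasing (F : ℝ → ℂ) : Prop :=
  ∀ s t : ℝ, s ≤ t → 0 ≤ (F t - F s).re ∧ (F t - F s).im = 0

end

end WienerSeries

namespace WienerSeries

open Filter Topology
open scoped ENNReal NNReal

/-! Everything rests on wrapping the line around the circle. If `μ` represents `φ`, push it forward
under `y ↦ -y` modulo `2π` (`reflectMod`). Integer frequencies do not notice reduction modulo `2π`,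
so the wrapped measure has coefficients `φ(k)`. A complex measure on a period is determined by its
coefficients (`eq_of_coeff_eq`, from density of trigonometric polynomials), so whenever `φ` extends
the coefficients of `dF`, the wrapped measure is `dF` (`dStieltjes_eq_map`). In the other direction,
the reflection of `dF`, seen as a measure on the line, represents `φ₀`.

Wrapping does not increase total variation, preserves positivity, and preserves absolute continuity.
These facts give the lower bound for the norm, the statement on increasing `F`, and the statement on
Fourier series. What remains is the dictionary between `F` and `dF`: every complex measure of finite
variation on the period is some `dF` (`exists_dStieltjes_eq`), and `V(F)` is the variation of `dF`
(`totalVar_eq`), where the normalization at jumps is essential.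

For extensions of exponential type at most `π`, the difference of two of them is bounded on the line
and vanishes at the integers. Divided by `sin πz` it is entire; Phragmén–Lindelöf and the maximum
principle show that the quotient is bounded, and Liouville makes it constant (`exists_eq_mul_sin`).
-/

/-! ### Complex measures as densities. -/

theorem integral_withDensityᵥ {X : Type*} [MeasurableSpace X] {m : Measure X} {h f : X → ℂ}
    (hh : Integrable h m) (hf : Integrable f (m.withDensityᵥ h).variation) :
    (m.withDensityᵥ h).integral f (ContinuousLinearMap.mul ℝ ℂ) = ∫ x, f x * h x ∂m := by
  have hvar : (m.withDensityᵥ h).variation = m.withDensity (fun x => ‖h x‖ₑ) :=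
    Measure.variation_withDensityᵥ hh
  set v := (m.withDensityᵥ h).variation with hv
  have hvm : v ≪ m := hvar ▸ withDensity_absolutelyContinuous _ _
  have : IsFiniteMeasure v := by
    rw [hvar]; exact isFiniteMeasure_withDensity hh.2.ne
  -- The phase of `h`, equal to `0` where `h` vanishes. The right-hand side becomes `∫ f u dv` with
  -- `|u| ≤ 1`, a 1-Lipschitz functional on `L¹(v)`, so the identity passes from indicators to all
  -- integrable `f`.
  let u : X → ℂ := fun x => (‖h x‖⁻¹ : ℝ) • h x
  have hu : AEStronglyMeasurable u v :=
    (hh.1.norm.aemeasurable.inv.aestronglyMeasurable.smul hh.1).mono_ac hvm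
  have hu1 : ∀ x, ‖u x‖ ≤ 1 := fun x => by
    rcases eq_or_ne (h x) 0 with h0 | h0
    · simp [u, h0]
    · simp [u, h0]
  have hfu : ∀ f : X → ℂ, ∫ x, f x * h x ∂m = ∫ x, f x * u x ∂v := fun f => by
    rw [hvar, integral_withDensity_eq_integral_toReal_smul₀ hh.1.enorm
      (Eventually.of_forall fun x => enorm_lt_top)]
    refine integral_congr_ae (Eventually.of_forall fun x => ?_)
    rcases eq_or_ne (h x) 0 with h0 | h0
    · simp [h0]
    · have : ((‖h x‖ : ℝ) : ℂ) ≠ 0 := by simpa using h0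
      simp only [u, toReal_enorm, Complex.real_smul, Complex.ofReal_inv]
      field_simp
  have hint : ∀ {f : X → ℂ}, Integrable f v → Integrable (fun x => f x * u x) v := fun hf =>
    hf.mul_bdd (c := 1) hu (Eventually.of_forall hu1)
  rw [hfu]
  refine Integrable.induction (μ := v) (fun f => (m.withDensityᵥ h).integral f
    (ContinuousLinearMap.mul ℝ ℂ) = ∫ x, f x * u x ∂v) ?_ ?_ ?_ ?_ hf
  · intro c s hs _
    have hfin : IsFiniteMeasure ((m.withDensityᵥ h).variation.restrict s) := by
      rw [← hv]; infer_instance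
    rw [VectorMeasure.integral_indicator_const _ hs, ← hfu, withDensityᵥ_apply hh hs]
    have h1 : ∀ x, s.indicator (fun _ => c) x * h x = s.indicator (fun x => c * h x) x := fun x => by
      by_cases hx : x ∈ s <;> simp [hx]
    simp_rw [h1]
    rw [integral_indicator hs, integral_const_mul]
    rfl
  · intro f g _ hf hg h1 h2
    have h3 : ∫ x, (f + g) x * u x ∂v = ∫ x, f x * u x ∂v + ∫ x, g x * u x ∂v := by
      simp_rw [Pi.add_apply, add_mul]
      exact integral_add (hint hf) (hint hg)
    rw [VectorMeasure.integral_add hf hg, h1, h2, h3]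
  · refine isClosed_eq VectorMeasure.continuous_integral ?_
    refine (LipschitzWith.of_dist_le_mul (K := 1) fun f g => ?_).continuous
    have hfi := L1.integrable_coeFn f
    have hgi := L1.integrable_coeFn g
    rw [dist_eq_norm, ← integral_sub (hint hfi) (hint hgi), NNReal.coe_one, one_mul, dist_eq_norm,
      L1.norm_eq_integral_norm]
    refine (norm_integral_le_integral_norm _).trans ?_
    refine integral_mono_ae ((hint hfi).sub (hint hgi)).norm (L1.integrable_coeFn _).norm ?_
    filter_upwards [Lp.coeFn_sub f g] with x hx
    rw [hx, Pi.sub_apply]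
    rw [← sub_mul, norm_mul]
    exact mul_le_of_le_one_right (norm_nonneg _) (hu1 x)
  · intro f g hfg _ h1
    rw [← VectorMeasure.integral_congr_ae hfg, h1]
    refine integral_congr_ae ?_
    filter_upwards [hfg] with x hx
    rw [hx]

/-- Radon–Nikodym for signed measures, applied to the real and imaginary parts. -/
theorem exists_withDensityᵥ_eq {X : Type*} [MeasurableSpace X] {m : Measure X} [SigmaFinite m]
    {ν : ComplexMeasure X} (hν : ∀ s, MeasurableSet s → m s = 0 → ν s = 0) :
    ∃ h : X → ℂ, Integrable h m ∧ ν = m.withDensityᵥ h := by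
  have hac : ν ≪ᵥ m.toENNRealVectorMeasure := by
    refine VectorMeasure.AbsolutelyContinuous.mk fun s hs h0 => hν s hs ?_
    rwa [Measure.toENNRealVectorMeasure_apply_measurable hs] at h0
  obtain ⟨hr, hi⟩ := (ComplexMeasure.absolutelyContinuous_ennreal_iff ν _).1 hac
  have hr' := (SignedMeasure.absolutelyContinuous_iff_withDensityᵥ_rnDeriv_eq _ _).1 hr
  have hi' := (SignedMeasure.absolutelyContinuous_iff_withDensityᵥ_rnDeriv_eq _ _).1 hi
  have hri := SignedMeasure.integrable_rnDeriv (ComplexMeasure.re ν) m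
  have hii := SignedMeasure.integrable_rnDeriv (ComplexMeasure.im ν) m
  have hint : Integrable (fun x => ((ComplexMeasure.re ν).rnDeriv m x : ℂ) +
      ((ComplexMeasure.im ν).rnDeriv m x : ℂ) * Complex.I) m :=
    hri.ofReal.add (hii.ofReal.mul_const _)
  refine ⟨_, hint, ?_⟩
  ext s hs
  have h1 : ∫ x in s, ((ComplexMeasure.re ν).rnDeriv m x : ℂ) +
      ((ComplexMeasure.im ν).rnDeriv m x : ℂ) * Complex.I ∂m = _ :=
    integral_add hri.ofReal.integrableOn (hii.ofReal.mul_const _).integrableOn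
  rw [withDensityᵥ_apply hint hs, h1, integral_mul_const, integral_complex_ofReal,
    integral_complex_ofReal, ← withDensityᵥ_apply hri hs, ← withDensityᵥ_apply hii hs, hr', hi']
  exact (Complex.re_add_im (ν s)).symm

theorem exists_variation_withDensityᵥ_eq {X : Type*} [MeasurableSpace X] (ν : ComplexMeasure X)
    [IsFiniteMeasure ν.variation] :
    ∃ h : X → ℂ, Integrable h ν.variation ∧ ν = ν.variation.withDensityᵥ h := by
  refine exists_withDensityᵥ_eq fun s _ h0 => ?_
  have := VectorMeasure.enorm_measure_le_variation ν s
  simpa [h0] using this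

/-! ### Uniqueness of measures, by intervals and by Fourier coefficients. -/

theorem isPiSystem_Ico_real : IsPiSystem {s : Set ℝ | ∃ a b, s = Ico a b} := by
  rintro _ ⟨a, b, rfl⟩ _ ⟨c, d, rfl⟩ _
  exact ⟨_, _, Ico_inter_Ico⟩

theorem generateFrom_Ico_real :
    (inferInstance : MeasurableSpace ℝ) =
      MeasurableSpace.generateFrom {s : Set ℝ | ∃ a b, s = Ico a b} := by
  refine le_antisymm ?_ ?_
  · have h : (inferInstance : MeasurableSpace ℝ) = _ := BorelSpace.measurable_eq.trans
      (borel_eq_generateFrom_Ico ℝ)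
    rw [h]
    refine MeasurableSpace.generateFrom_mono ?_
    rintro s ⟨l, u, _, rfl⟩
    exact ⟨l, u, rfl⟩
  · refine MeasurableSpace.generateFrom_le ?_
    rintro s ⟨l, u, rfl⟩
    exact measurableSet_Ico

theorem ext_of_Ico {μ ν : ComplexMeasure ℝ} {a b : ℝ}
    (hμ : μ.restrict (Ico a b) = μ) (hν : ν.restrict (Ico a b) = ν)
    (h : ∀ s t, a ≤ s → s ≤ t → t ≤ b → μ (Ico s t) = ν (Ico s t)) : μ = ν := by
  have key : ∀ s t, μ (Ico s t) = ν (Ico s t) := by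
    intro s t
    rw [← hμ, ← hν, VectorMeasure.restrict_apply _ measurableSet_Ico measurableSet_Ico,
      VectorMeasure.restrict_apply _ measurableSet_Ico measurableSet_Ico, Ico_inter_Ico]
    rcases le_total (s ⊔ a) (t ⊓ b) with h1 | h1
    · exact h _ _ le_sup_right h1 inf_le_right
    · rw [Ico_eq_empty (not_lt.2 h1)]; simp
  refine VectorMeasure.ext_of_generateFrom _ ?_ generateFrom_Ico_real isPiSystem_Ico_real ?_
  · rintro _ ⟨s, t, rfl⟩
    exact key s t
  · rw [← hμ, ← hν, VectorMeasure.restrict_apply _ measurableSet_Ico MeasurableSet.univ,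
      VectorMeasure.restrict_apply _ measurableSet_Ico MeasurableSet.univ, univ_inter, key]

/-- The integral is built on the real bilinear pairing `ContinuousLinearMap.mul ℝ ℂ`, so complex
homogeneity is not built in; the density formula supplies it. -/
theorem integral_const_mul_complex {X : Type*} [MeasurableSpace X] (ν : ComplexMeasure X)
    [IsFiniteMeasure ν.variation] (c : ℂ) {f : X → ℂ} (hf : Integrable f ν.variation) :
    ν.integral (fun x => c * f x) (ContinuousLinearMap.mul ℝ ℂ) =
      c * ν.integral f (ContinuousLinearMap.mul ℝ ℂ) := by
  obtain ⟨h, hh, e⟩ := exists_variation_withDensityᵥ_eq ν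
  -- `ν` occurs on both sides of `e`, on the right through its variation; a new name for the latter
  -- allows `subst`.
  generalize ν.variation = m at hh e
  subst e
  rw [integral_withDensityᵥ hh hf, integral_withDensityᵥ hh (hf.const_mul c),
    ← MeasureTheory.integral_const_mul]
  simp_rw [mul_assoc]

theorem integrable_of_norm_le {X : Type*} [MeasurableSpace X] {m : Measure X} [IsFiniteMeasure m]
    {f : X → ℂ} (hf : AEStronglyMeasurable f m) (C : ℝ) (h : ∀ x, ‖f x‖ ≤ C) : Integrable f m :=
  Integrable.of_bound hf C (Eventually.of_forall h)

/-- Indicators of closed sets are bounded pointwise limits of continuous functions, so dominated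
convergence makes `ν` vanish on closed sets, a generating π-system. -/
theorem eq_zero_of_integral_continuous {X : Type*} [TopologicalSpace X] [MeasurableSpace X]
    [BorelSpace X] [HasOuterApproxClosed X] [CompactSpace X]
    {ν : ComplexMeasure X} [IsFiniteMeasure ν.variation]
    (h : ∀ f : C(X, ℂ), ν.integral f (ContinuousLinearMap.mul ℝ ℂ) = 0) : ν = 0 := by
  have key : ∀ F : Set X, IsClosed F → ν F = 0 := by
    intro F hF
    have hlim : Tendsto (fun n => ν.integral (fun x => ((hF.apprSeq n x : ℝ) : ℂ))
        (ContinuousLinearMap.mul ℝ ℂ)) atTop (𝓝 (ν.integral (F.indicator fun _ => (1 : ℂ))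
        (ContinuousLinearMap.mul ℝ ℂ))) := by
      refine VectorMeasure.tendsto_integral_filter_of_norm_le_const (Eventually.of_forall fun n => ?_)
        ⟨1, Eventually.of_forall fun n => Eventually.of_forall fun x => ?_⟩
        (Eventually.of_forall fun x => ?_)
      · have : Continuous (fun x => ((hF.apprSeq n x : ℝ) : ℂ)) := by fun_prop
        exact this.aestronglyMeasurable
      · simpa using HasOuterApproxClosed.apprSeq_apply_le_one hF n x
      · have h1 := (tendsto_pi_nhds.1 (HasOuterApproxClosed.tendsto_apprSeq hF)) x
        have h2 : Tendsto (fun n => ((hF.apprSeq n x : ℝ) : ℂ)) atTop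
            (𝓝 ((((F.indicator (fun _ => (1 : ℝ≥0)) x : ℝ≥0) : ℝ)) : ℂ)) :=
          (Complex.continuous_ofReal.comp NNReal.continuous_coe).continuousAt.tendsto.comp h1
        convert h2 using 2
        by_cases hx : x ∈ F <;> simp [hx]
    rw [VectorMeasure.integral_indicator_const _ hF.measurableSet] at hlim
    have h0 : ∀ n, ν.integral (fun x => ((hF.apprSeq n x : ℝ) : ℂ))
        (ContinuousLinearMap.mul ℝ ℂ) = 0 := fun n =>
      h ⟨fun x => ((hF.apprSeq n x : ℝ) : ℂ), by fun_prop⟩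
    simp_rw [h0] at hlim
    simpa using tendsto_nhds_unique hlim tendsto_const_nhds
  refine VectorMeasure.ext_of_generateFrom {F | IsClosed F} (fun F hF => by simpa using key F hF) ?_
    isPiSystem_isClosed (by simpa using key univ isClosed_univ)
  exact BorelSpace.measurable_eq.trans borel_eq_generateFrom_isClosed

/-- Integration against `ν` is a continuous functional on `C(AddCircle T, ℂ)` that kills the span of
the characters, which is dense. -/
theorem eq_zero_of_fourier {T : ℝ} [Fact (0 < T)] {ν : ComplexMeasure (AddCircle T)}
    [IsFiniteMeasure ν.variation]
    (h : ∀ n : ℤ, ν.integral (fourier n) (ContinuousLinearMap.mul ℝ ℂ) = 0) : ν = 0 := by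
  have hint : ∀ f : C(AddCircle T, ℂ), Integrable f ν.variation := fun f =>
    integrable_of_norm_le f.continuous.aestronglyMeasurable ‖f‖ f.norm_coe_le_norm
  let L : C(AddCircle T, ℂ) →ₗ[ℂ] ℂ :=
    { toFun := fun f => ν.integral f (ContinuousLinearMap.mul ℝ ℂ)
      map_add' := fun f g => VectorMeasure.integral_add (hint f) (hint g)
      map_smul' := fun c f => integral_const_mul_complex ν c (hint f) }
  have hL : Continuous L := by
    refine (L.mkContinuous (‖ContinuousLinearMap.mul ℝ ℂ‖ * ν.variation.real univ) fun f => ?_).2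
    refine (VectorMeasure.norm_integral_le_integral_norm).trans ?_
    rw [mul_assoc]
    refine mul_le_mul_of_nonneg_left ?_ (by positivity)
    refine (integral_mono (hint f).norm (integrable_const ‖f‖) f.norm_coe_le_norm).trans ?_
    simp
  refine eq_zero_of_integral_continuous fun f => ?_
  have hker : IsClosed (L.ker : Set C(AddCircle T, ℂ)) := by
    have : (L.ker : Set C(AddCircle T, ℂ)) = L ⁻¹' {0} := by ext; simp
    rw [this]
    exact isClosed_singleton.preimage hL
  have hle : Submodule.span ℂ (range (@fourier T)) ≤ L.ker := by
    rw [Submodule.span_le]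
    rintro _ ⟨n, rfl⟩
    exact h n
  have htop := Submodule.topologicalClosure_minimal _ hle hker
  rw [span_fourier_closure_eq_top] at htop
  exact htop (Submodule.mem_top (x := f))

instance fact_two_pi_pos : Fact (0 < 2 * π) := ⟨Real.two_pi_pos⟩

theorem norm_exp_neg_I (x t : ℝ) : ‖Complex.exp (-(Complex.I * x * t))‖ = 1 := by
  rw [show -(Complex.I * x * t) = ((-(x * t) : ℝ) : ℂ) * Complex.I by push_cast; ring,
    Complex.norm_exp_ofReal_mul_I]

theorem norm_exp_I (x t : ℝ) : ‖Complex.exp (Complex.I * x * t)‖ = 1 := by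
  rw [show Complex.I * x * t = ((x * t : ℝ) : ℂ) * Complex.I by push_cast; ring,
    Complex.norm_exp_ofReal_mul_I]

theorem integrable_exp_neg_I (m : Measure ℝ) [IsFiniteMeasure m] (x : ℝ) :
    Integrable (fun t : ℝ => Complex.exp (-(Complex.I * x * t))) m :=
  integrable_of_norm_le (by fun_prop) 1 fun t => (norm_exp_neg_I x t).le

theorem integrable_exp_I (m : Measure ℝ) [IsFiniteMeasure m] (x : ℝ) :
    Integrable (fun t : ℝ => Complex.exp (Complex.I * x * t)) m :=
  integrable_of_norm_le (by fun_prop) 1 fun t => (norm_exp_I x t).le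

/-- A complex measure carried by a period is determined by its Fourier coefficients. -/
theorem eq_of_coeff_eq {μ ν : ComplexMeasure ℝ} [IsFiniteMeasure μ.variation]
    [IsFiniteMeasure ν.variation] (hμ : μ.restrict (Ico (-π) π) = μ)
    (hν : ν.restrict (Ico (-π) π) = ν)
    (h : ∀ k : ℤ, μ.integral (fun t : ℝ => Complex.exp (-(Complex.I * k * t)))
        (ContinuousLinearMap.mul ℝ ℂ) =
      ν.integral (fun t : ℝ => Complex.exp (-(Complex.I * k * t)))
        (ContinuousLinearMap.mul ℝ ℂ)) : μ = ν := by
  have hcoe : Measurable (fun t : ℝ => (t : AddCircle (2 * π))) :=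
    AddCircle.measurable_mk'
  have hfin : IsFiniteMeasure (μ - ν).variation :=
    isFiniteMeasure_of_le _ VectorMeasure.variation_sub_le
  have hzero : (μ - ν).map (fun t : ℝ => (t : AddCircle (2 * π))) = 0 := by
    refine eq_zero_of_fourier fun n => ?_
    have hfun : ∀ t : ℝ, fourier n (t : AddCircle (2 * π)) =
        Complex.exp (-(Complex.I * ((-n : ℤ) : ℝ) * t)) := fun t => by
      rw [fourier_coe_apply]
      congr 1
      have : (π : ℂ) ≠ 0 := by exact_mod_cast Real.pi_ne_zero
      push_cast
      field_simp
    have h2 : (fun t : ℝ => fourier n (t : AddCircle (2 * π))) =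
        fun t : ℝ => Complex.exp (-(Complex.I * ((-n : ℤ) : ℝ) * t)) := funext hfun
    rw [VectorMeasure.integral_map hcoe (fourier n).continuous.aestronglyMeasurable
      (by rw [Function.comp_def, h2]; exact integrable_exp_neg_I _ _), h2,
      VectorMeasure.integral_sub_vectorMeasure (integrable_exp_neg_I _ _) (integrable_exp_neg_I _ _),
      sub_eq_zero]
    simpa using h (-n)
  refine sub_eq_zero.1 ?_
  ext E hE
  have hres : (μ - ν).restrict (Ico (-π) π) = μ - ν := by
    rw [VectorMeasure.restrict_sub, hμ, hν]
  have hI : -π + 2 * π = π := by ring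
  -- The quotient map is injective on `[-π, π)`, so the part of `E` in the period is recovered as
  -- the preimage of a Borel set of the circle.
  let S : Set (AddCircle (2 * π)) :=
    {z | ((AddCircle.equivIco (2 * π) (-π) z : Ico (-π) (-π + 2 * π)) : ℝ) ∈ E}
  have hS : MeasurableSet S :=
    (measurable_subtype_coe.comp (AddCircle.measurableEquivIco (2 * π) (-π)).measurable) hE
  have h3 : (fun t : ℝ => (t : AddCircle (2 * π))) ⁻¹' S ∩ Ico (-π) π = E ∩ Ico (-π) π := by
    ext t
    simp only [mem_inter_iff, mem_preimage, S, mem_ofPred_eq, and_congr_left_iff]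
    intro ht
    rw [AddCircle.equivIco_coe_of_mem (by rwa [hI])]
  have h4 := congrArg (fun ρ : ComplexMeasure (AddCircle (2 * π)) => ρ S) hzero
  simp only [VectorMeasure.map_apply _ hcoe hS] at h4
  rw [← hres, VectorMeasure.restrict_apply _ measurableSet_Ico hE, ← h3,
    ← VectorMeasure.restrict_apply _ measurableSet_Ico (hcoe hS), hres, h4]
  rfl

/-! ### The Stieltjes measure of `F` and its total variation. -/

theorem eVariationOn_le_of_dist_le {E : Type*} [PseudoMetricSpace E] {F : ℝ → E} {G : ℝ → ℝ}
    {s : Set ℝ} (h : ∀ x ∈ s, ∀ y ∈ s, x ≤ y → dist (F x) (F y) ≤ G y - G x) :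
    eVariationOn F s ≤ eVariationOn G s := by
  refine iSup_le fun p => ?_
  refine le_trans (Finset.sum_le_sum fun i _ => ?_) (eVariationOn.sum_le (f := G) p.2.2.1 fun i => p.2.2.2 i)
  have h1 := h _ (p.2.2.2 i) _ (p.2.2.2 (i + 1)) (p.2.2.1 (Nat.le_succ i))
  rw [edist_comm, edist_dist, edist_dist]
  refine ENNReal.ofReal_le_ofReal (h1.trans ?_)
  rw [Real.dist_eq]
  exact le_abs_self _

theorem isFiniteMeasure_stieltjesFunctionRightLim {f : ℝ → ℂ} (hf : BoundedVariationOn f univ) :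
    IsFiniteMeasure (hf.stieltjesFunctionRightLim 0).measure := by
  apply StieltjesFunction.isFiniteMeasure_of_forall_abs_le
    (C := (eVariationOn f.rightLim univ).toReal) _ (fun x ↦ ?_)
  exact variationOnFromTo.abs_le_eVariationOn hf.rightLim

theorem stieltjesFunctionRightLim_measure_Ioc {f : ℝ → ℂ} (hf : BoundedVariationOn f univ)
    {u v : ℝ} (huv : u ≤ v) :
    (hf.stieltjesFunctionRightLim 0).measure (Ioc u v) =
      eVariationOn (Function.rightLim f) (Icc u v) := by
  rw [StieltjesFunction.measure_Ioc, BoundedVariationOn.stieltjesFunctionRightLim_apply,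
    BoundedVariationOn.stieltjesFunctionRightLim_apply,
    ← variationOnFromTo.add hf.rightLim.locallyBoundedVariationOn
      (mem_univ 0) (mem_univ u) (mem_univ v)]
  simp only [add_sub_cancel_left, variationOnFromTo, huv, ↓reduceIte, univ_inter]
  rw [ENNReal.ofReal_toReal]
  exact ((eVariationOn.mono _ (subset_univ _)).trans_lt hf.rightLim.lt_top).ne

theorem eq_of_Ioc {μ ν : ComplexMeasure ℝ}
    (h : ∀ u v : ℝ, u ≤ v → μ (Ioc u v) = ν (Ioc u v)) : μ = ν := by
  refine VectorMeasure.ext_of_generateFrom {s | ∃ u v : ℝ, u ≤ v ∧ s = Ioc u v} ?_ ?_ ?_ ?_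
  · rintro _ ⟨u, v, huv, rfl⟩
    exact h u v huv
  · refine BorelSpace.measurable_eq.trans ?_
    convert! borel_eq_generateFrom_Ioc_le ℝ using 2
    grind only
  · rintro _ ⟨a, b, _, rfl⟩ _ ⟨c, d, _, rfl⟩ hne
    rw [Ioc_inter_Ioc] at hne ⊢
    exact ⟨_, _, (nonempty_Ioc.1 hne).le, rfl⟩
  · have hU : (univ : Set ℝ) = ⋃ n : ℕ, Ioc (-(n : ℝ)) n := by
      refine (eq_univ_of_forall fun x => ?_).symm
      obtain ⟨n, hn⟩ := exists_nat_gt |x|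
      exact mem_iUnion.2 ⟨n, (abs_lt.1 hn).1, (abs_lt.1 hn).2.le⟩
    have hm : Monotone fun n : ℕ => Ioc (-(n : ℝ)) n := fun a b hab =>
      Ioc_subset_Ioc (neg_le_neg (by exact_mod_cast hab)) (by exact_mod_cast hab)
    have h1 := μ.tendsto_vectorMeasure_iUnion_atTop_nat hm fun n => measurableSet_Ioc
    have h2 := ν.tendsto_vectorMeasure_iUnion_atTop_nat hm fun n => measurableSet_Ioc
    rw [← hU] at h1 h2
    refine tendsto_nhds_unique h1 (h2.congr fun n => (h _ _ ?_).symm)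
    exact neg_le_self n.cast_nonneg

/-- The increment of `f.rightLim` over `(u, v]` is at most its variation there, which is the mass
given by the positive measure. This bound on the semiring of intervals survives the extension to
Borel sets, and the extension is the Stieltjes measure because the two agree on intervals. -/
theorem variation_vectorMeasure_le {f : ℝ → ℂ} (hf : BoundedVariationOn f univ) :
    hf.vectorMeasure.variation ≤ (hf.stieltjesFunctionRightLim 0).measure := by
  have := isFiniteMeasure_stieltjesFunctionRightLim hf
  have A : ∀ s ∈ {s | ∃ u v : ℝ, u ≤ v ∧ s = Ioc u v},
      ‖AddContent.onIoc (Function.rightLim f) s‖ₑ ≤ (hf.stieltjesFunctionRightLim 0).measure s := by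
    rintro s ⟨u, v, huv, rfl⟩
    rw [AddContent.onIoc_apply huv, stieltjesFunctionRightLim_measure_Ioc hf huv,
      ← edist_eq_enorm_sub]
    exact eVariationOn.edist_le _ ⟨huv, le_rfl⟩ ⟨le_rfl, huv⟩
  have B : (inferInstance : MeasurableSpace ℝ) =
      MeasurableSpace.generateFrom {s | ∃ u v : ℝ, u ≤ v ∧ s = Ioc u v} := by
    refine BorelSpace.measurable_eq.trans ?_
    convert! borel_eq_generateFrom_Ioc_le ℝ using 2
    grind only
  obtain ⟨m', hm', hle⟩ := VectorMeasure.exists_extension_of_isSetSemiring_of_le_measure_of_generateFrom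
    IsSetSemiring.Ioc A B
  have heq : m' = hf.vectorMeasure := eq_of_Ioc fun u v huv => by
    rw [hm' _ ⟨u, v, huv, rfl⟩, AddContent.onIoc_apply huv, hf.vectorMeasure_Ioc huv]
  subst heq
  exact VectorMeasure.variation_le_of_forall_enorm_le fun E _ => hle E

theorem isFiniteMeasure_variation_vectorMeasure {f : ℝ → ℂ} (hf : BoundedVariationOn f univ) :
    IsFiniteMeasure hf.vectorMeasure.variation :=
  have := isFiniteMeasure_stieltjesFunctionRightLim hf
  isFiniteMeasure_of_le _ (variation_vectorMeasure_le hf)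

variable {F : ℝ → ℂ}

theorem tendsto_leftLim_of_locallyBV (hF : LocallyBoundedVariationOn F univ) (t : ℝ) :
    Tendsto F (𝓝[<] t) (𝓝 (Function.leftLim F t)) := by
  apply tendsto_leftLim_of_tendsto
  have h : BoundedVariationOn F (univ ∩ Icc (t - 1) (t + 1)) :=
    hF _ _ (mem_univ _) (mem_univ _)
  obtain ⟨l, hl⟩ := h.exists_tendsto_left t
  refine ⟨l, hl.mono_left ?_⟩
  rw [univ_inter]
  refine le_inf nhdsWithin_le_nhds (le_principal_iff.2 ?_)
  filter_upwards [Ico_mem_nhdsLT (show t - 1 < t by linarith)] with x hx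
  exact ⟨⟨hx.1, by linarith [hx.2]⟩, hx.2⟩

theorem tendsto_rightLim_of_locallyBV (hF : LocallyBoundedVariationOn F univ) (t : ℝ) :
    Tendsto F (𝓝[>] t) (𝓝 (Function.rightLim F t)) := by
  apply tendsto_rightLim_of_tendsto
  have h : BoundedVariationOn F (univ ∩ Icc (t - 1) (t + 1)) :=
    hF _ _ (mem_univ _) (mem_univ _)
  obtain ⟨l, hl⟩ := h.exists_tendsto_right t
  refine ⟨l, hl.mono_left ?_⟩
  rw [univ_inter]
  refine le_inf nhdsWithin_le_nhds (le_principal_iff.2 ?_)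
  filter_upwards [Ioc_mem_nhdsGT (show t < t + 1 by linarith)] with x hx
  exact ⟨⟨by linarith [hx.1], hx.2⟩, hx.1⟩

theorem IsBVCircle.tendsto_leftLim (hF : IsBVCircle F) (t : ℝ) :
    Tendsto F (𝓝[<] t) (𝓝 (Function.leftLim F t)) :=
  tendsto_leftLim_of_locallyBV hF.locallyBV t

theorem IsBVCircle.tendsto_rightLim (hF : IsBVCircle F) (t : ℝ) :
    Tendsto F (𝓝[>] t) (𝓝 (Function.rightLim F t)) :=
  tendsto_rightLim_of_locallyBV hF.locallyBV t

theorem leftLim_add_period {m : ℂ} (hF : LocallyBoundedVariationOn F univ) (hm : ∀ t, F (t + 2 * π) = F t + m) (t : ℝ) :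
    Function.leftLim F (t + 2 * π) = Function.leftLim F t + m := by
  refine leftLim_eq_of_tendsto ?_
  have h1 : Tendsto (fun x => x - 2 * π) (𝓝[<] (t + 2 * π)) (𝓝[<] t) := by
    refine tendsto_nhdsWithin_iff.2 ⟨?_, ?_⟩
    · have : Tendsto (fun x => x - 2 * π) (𝓝 (t + 2 * π)) (𝓝 (t + 2 * π - 2 * π)) :=
        (continuous_id.sub continuous_const).tendsto _
      rw [add_sub_cancel_right] at this
      exact this.mono_left nhdsWithin_le_nhds
    · filter_upwards [self_mem_nhdsWithin] with x hx
      have : x < t + 2 * π := hx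
      exact sub_lt_iff_lt_add.2 this
  refine (((tendsto_leftLim_of_locallyBV hF t).comp h1).add_const m).congr fun x => ?_
  rw [Function.comp_apply, ← hm, sub_add_cancel]

theorem clamp_eq {t : ℝ} (h1 : -(2 * π) ≤ t) (h2 : t ≤ 2 * π) : clamp F t = F t := by
  rw [clamp, min_eq_left h2, max_eq_right h1]

theorem clamp_eventuallyEq {t : ℝ} (h1 : -(2 * π) < t) (h2 : t < 2 * π) : F =ᶠ[𝓝 t] clamp F := by
  filter_upwards [Ioo_mem_nhds h1 h2] with x hx
  exact (clamp_eq hx.1.le hx.2.le).symm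

theorem leftLim_clamp (hF : IsBVCircle F) {t : ℝ} (h1 : -(2 * π) < t) (h2 : t < 2 * π) :
    Function.leftLim (clamp F) t = Function.leftLim F t :=
  leftLim_eq_of_tendsto
    ((hF.tendsto_leftLim t).congr' (nhdsWithin_le_nhds (clamp_eventuallyEq h1 h2)))

theorem rightLim_clamp (hF : IsBVCircle F) {t : ℝ} (h1 : -(2 * π) < t) (h2 : t < 2 * π) :
    Function.rightLim (clamp F) t = Function.rightLim F t :=
  rightLim_eq_of_tendsto
    ((hF.tendsto_rightLim t).congr' (nhdsWithin_le_nhds (clamp_eventuallyEq h1 h2)))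

theorem dStieltjes_restrict (hF : IsBVCircle F) :
    (dStieltjes hF).restrict (Ico (-π) π) = dStieltjes hF := by
  ext s hs
  rw [dStieltjes, VectorMeasure.restrict_apply _ measurableSet_Ico hs,
    VectorMeasure.restrict_apply _ measurableSet_Ico (hs.inter measurableSet_Ico),
    VectorMeasure.restrict_apply _ measurableSet_Ico hs, inter_assoc, inter_self]

theorem dStieltjes_apply (hF : IsBVCircle F) {s : Set ℝ} (hs : MeasurableSet s)
    (hsub : s ⊆ Ico (-π) π) :
    dStieltjes hF s = hF.boundedVariationOn_clamp.vectorMeasure s := by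
  rw [dStieltjes, VectorMeasure.restrict_apply _ measurableSet_Ico hs, inter_eq_left.2 hsub]

theorem dStieltjes_Ico (hF : IsBVCircle F) {a b : ℝ} (ha : -π ≤ a) (hab : a ≤ b) (hb : b ≤ π) :
    dStieltjes hF (Ico a b) = Function.leftLim F b - Function.leftLim F a := by
  have := Real.pi_pos
  rw [dStieltjes_apply hF measurableSet_Ico (Ico_subset_Ico ha hb),
    BoundedVariationOn.vectorMeasure_Ico _ hab,
    leftLim_clamp hF (by linarith) (by linarith), leftLim_clamp hF (by linarith) (by linarith)]

theorem dStieltjes_Ioo (hF : IsBVCircle F) {a b : ℝ} (ha : -π ≤ a) (hab : a < b) (hb : b ≤ π) :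
    dStieltjes hF (Ioo a b) = Function.leftLim F b - Function.rightLim F a := by
  have := Real.pi_pos
  rw [dStieltjes_apply hF measurableSet_Ioo fun x hx => ⟨ha.trans hx.1.le, hx.2.trans_le hb⟩,
    BoundedVariationOn.vectorMeasure_Ioo _ hab,
    leftLim_clamp hF (by linarith) (by linarith), rightLim_clamp hF (by linarith) (by linarith)]

theorem dStieltjes_singleton (hF : IsBVCircle F) {a : ℝ} (ha : -π ≤ a) (hb : a < π) :
    dStieltjes hF {a} = Function.rightLim F a - Function.leftLim F a := by
  have := Real.pi_pos
  rw [dStieltjes_apply hF (measurableSet_singleton a) (singleton_subset_iff.2 ⟨ha, hb⟩),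
    BoundedVariationOn.vectorMeasure_singleton,
    leftLim_clamp hF (by linarith) (by linarith), rightLim_clamp hF (by linarith) (by linarith)]

instance isFiniteMeasure_variation_dStieltjes (hF : IsBVCircle F) :
    IsFiniteMeasure (dStieltjes hF).variation :=
  have := isFiniteMeasure_variation_vectorMeasure hF.boundedVariationOn_clamp
  isFiniteMeasure_of_le _ VectorMeasure.variation_restrict_le

theorem norm_sub_leftLim_add (hF : IsBVCircle F) (t : ℝ) :
    ‖F t - Function.leftLim F t‖ + ‖Function.rightLim F t - F t‖ =
      ‖Function.rightLim F t - Function.leftLim F t‖ := by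
  have := dist_add_dist_of_mem_segment (hF.normalized t)
  rw [dist_eq_norm, dist_eq_norm, dist_eq_norm] at this
  rw [norm_sub_rev (F t) (Function.leftLim F t), norm_sub_rev (Function.rightLim F t) (F t), this,
    norm_sub_rev]

/-- Since `F x` lies on the segment between its one-sided limits, `|dF|{x}` dominates the sum of the
jump into `F x` and the jump out of it. Hence increments of `F` are dominated by those of a monotone
`G` whose total increase is the variation of `dF`. -/
theorem eVariationOn_le_variation_dStieltjes (hF : IsBVCircle F) :
    eVariationOn F (Icc (-π) π) ≤ (dStieltjes hF).variation univ := by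
  have hpi := Real.pi_pos
  set v := (dStieltjes hF).variation with hv
  -- The second term is the part of the jump at `t` already made when `F` takes its value there.
  let G : ℝ → ℝ := fun t => v.real (Ico (-π) t) + ‖F t - Function.leftLim F t‖
  have hle : ∀ E, ‖dStieltjes hF E‖ ≤ v.real E := fun E =>
    VectorMeasure.norm_measure_le_variation
  have key : ∀ x ∈ Icc (-π) π, ∀ y ∈ Icc (-π) π, x ≤ y → dist (F x) (F y) ≤ G y - G x := by
    intro x hx y hy hxy
    rcases hxy.eq_or_lt with rfl | hlt
    · simp
    have h1 : v.real (Ico (-π) y) = v.real (Ico (-π) x) + (v.real {x} + v.real (Ioo x y)) := by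
      rw [← Ico_union_Ico_eq_Ico hx.1 hxy, measureReal_union (by
        rw [Set.disjoint_left]; intro z h1 h2; exact absurd h1.2 (not_lt.2 h2.1)) measurableSet_Ico,
        ← Ioo_union_left hlt, union_comm, measureReal_union (by simp) measurableSet_Ioo]
    have h2 := hle {x}
    have h3 := hle (Ioo x y)
    rw [dStieltjes_singleton hF hx.1 (hlt.trans_le hy.2), ← norm_sub_leftLim_add hF] at h2
    rw [dStieltjes_Ioo hF hx.1 hlt hy.2] at h3
    have h4 : dist (F x) (F y) ≤ ‖F y - Function.leftLim F y‖ +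
        ‖Function.leftLim F y - Function.rightLim F x‖ + ‖Function.rightLim F x - F x‖ := by
      rw [dist_comm, dist_eq_norm]
      refine le_trans (le_of_eq ?_) (norm_add₃_le)
      congr 1
      ring
    simp only [G]
    linarith
  refine (eVariationOn_le_of_dist_le key).trans ?_
  have hmono : MonotoneOn G (Icc (-π) π) := fun x hx y hy hxy => by
    have := key x hx y hy hxy
    linarith [dist_nonneg (x := F x) (y := F y)]
  have h5 := hmono.eVariationOn_eq (a := -π) (b := π) ⟨le_rfl, by linarith⟩ ⟨by linarith, le_rfl⟩
  rw [inter_self] at h5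
  refine h5.le.trans ?_
  obtain ⟨m, hm⟩ := hF.periodic_increment
  have h6 : F π - Function.leftLim F π = F (-π) - Function.leftLim F (-π) := by
    have e1 := hm (-π)
    have e2 := leftLim_add_period hF.locallyBV hm (-π)
    rw [show -π + 2 * π = π by ring] at e1 e2
    rw [e1, e2]; ring
  simp only [G, h6, Ico_self, measureReal_empty]
  rw [zero_add, add_sub_cancel_right, ofReal_measureReal]
  exact measure_mono (subset_univ _)

/-- The atom at `-π` involves values of `F` to the left of `-π`, so `[-π, π]` does not control it
directly. For `b < π`, however, a neighbourhood of `[-π, b]` fits into another period, over which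
`F` has the same variation; then `b` tends to `π`. -/
theorem variation_dStieltjes_le (hF : IsBVCircle F) :
    (dStieltjes hF).variation univ ≤ eVariationOn F (Icc (-π) π) := by
  have hpi := Real.pi_pos
  have hf := hF.boundedVariationOn_clamp
  obtain ⟨m, hm⟩ := hF.periodic_increment
  have hshift : ∀ a, -(2 * π) ≤ a → a ≤ -π →
      eVariationOn F (Icc a (a + 2 * π)) = eVariationOn F (Icc (-π) π) := by
    intro a ha1 ha2
    have h1 : eVariationOn F (Icc a (-π)) = eVariationOn F (Icc (a + 2 * π) π) := by
      have h2 : Icc (a + 2 * π) π = (fun t => t + 2 * π) '' Icc a (-π) := by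
        rw [image_add_const_Icc]; congr 1; ring
      rw [h2, ← eVariationOn.comp_eq_of_monotoneOn F (t := Icc a (-π)) (fun t => t + 2 * π)
        fun x _ y _ hxy => by simpa using hxy]
      refine (?_ : eVariationOn F _ = eVariationOn (F ∘ fun t => t + 2 * π) _)
      unfold eVariationOn
      simp only [Function.comp_apply, hm, edist_add_right]
    have e1 := eVariationOn.Icc_add_Icc F (s := univ) ha2 (show -π ≤ a + 2 * π by linarith)
      (mem_univ _)
    have e2 := eVariationOn.Icc_add_Icc F (s := univ) (show -π ≤ a + 2 * π by linarith)
      (show a + 2 * π ≤ π by linarith) (mem_univ _)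
    simp only [univ_inter] at e1 e2
    rw [← e1, ← e2, h1, add_comm]
  have key : ∀ b, b < π → (dStieltjes hF).variation (Ico (-π) b) ≤ eVariationOn F (Icc (-π) π) := by
    intro b hb
    rcases le_or_gt b (-π) with h0 | h0
    · rw [Ico_eq_empty (not_lt.2 h0)]; simp
    -- Margins of `2δ` on the left and `δ` on the right must fit into the gap `π - b`; also `2δ <
    -- π`, so that `clamp F` is still `F` on the enlarged interval.
    set δ := (π - b) / 4 with hδ
    have hδ0 : 0 < δ := by rw [hδ]; linarith
    have hδ1 : 2 * δ < π := by rw [hδ]; linarith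
    calc (dStieltjes hF).variation (Ico (-π) b)
        ≤ hf.vectorMeasure.variation (Ico (-π) b) :=
          (VectorMeasure.variation_restrict_le _).trans (Measure.restrict_apply_le _ _)
      _ ≤ hf.vectorMeasure.variation (Ioc (-π - δ) b) :=
          measure_mono fun x hx => ⟨by linarith [hx.1], hx.2.le⟩
      _ ≤ (hf.stieltjesFunctionRightLim 0).measure (Ioc (-π - δ) b) :=
          variation_vectorMeasure_le hf _
      _ = eVariationOn (Function.rightLim (clamp F)) (Icc (-π - δ) b) :=
          stieltjesFunctionRightLim_measure_Ioc hf (by linarith)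
      _ ≤ eVariationOn (Function.rightLim (clamp F)) (Ioo (-π - 2 * δ) (b + δ)) :=
          eVariationOn.mono _ fun x hx => ⟨by linarith [hx.1], by linarith [hx.2]⟩
      _ ≤ eVariationOn (clamp F) (Ioo (-π - 2 * δ) (b + δ)) :=
          eVariationOn.eVariationOn_rightLim_le isOpen_Ioo
      _ = eVariationOn F (Ioo (-π - 2 * δ) (b + δ)) :=
          eVariationOn.congr fun x hx => clamp_eq (by linarith [hx.1]) (by linarith [hx.2])
      _ ≤ eVariationOn F (Icc (-π - 2 * δ) (-π - 2 * δ + 2 * π)) :=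
          eVariationOn.mono _ fun x hx => ⟨hx.1.le, by linarith [hx.2]⟩
      _ = eVariationOn F (Icc (-π) π) := hshift _ (by linarith) (by linarith)
  have hun : (dStieltjes hF).variation univ = (dStieltjes hF).variation (Ico (-π) π) := by
    rw [← dStieltjes_restrict hF, VectorMeasure.variation_restrict measurableSet_Ico,
      Measure.restrict_apply_univ, Measure.restrict_apply_self]
  have hU : Ico (-π) π = ⋃ n : ℕ, Ico (-π) (π - 1 / ((n : ℝ) + 1)) := by
    ext x
    simp only [mem_Ico, mem_iUnion]
    constructor
    · rintro ⟨h1, h2⟩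
      obtain ⟨n, hn⟩ := exists_nat_one_div_lt (sub_pos.2 h2)
      exact ⟨n, h1, by linarith⟩
    · rintro ⟨n, h1, h2⟩
      exact ⟨h1, by linarith [Nat.one_div_pos_of_nat (α := ℝ) (n := n)]⟩
  rw [hun, hU, Monotone.measure_iUnion]
  · exact iSup_le fun n => key _ (by linarith [Nat.one_div_pos_of_nat (α := ℝ) (n := n)])
  · intro i j hij
    exact Ico_subset_Ico_right (by linarith [Nat.one_div_le_one_div (α := ℝ) hij])

theorem totalVar_eq (hF : IsBVCircle F) :
    totalVar F = ((dStieltjes hF).variation univ).toReal := by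
  rw [totalVar, le_antisymm (eVariationOn_le_variation_dStieltjes hF) (variation_dStieltjes_le hF)]

/-! ### Building `F` from a measure on the period. -/

/-- A transitive relation invariant under the period holds for all `a ≤ b` as soon as it holds
within one period. -/
theorem of_periodic_of_trans {ρ : ℝ → ℝ → Prop} (trans : ∀ a b c, ρ a b → ρ b c → ρ a c)
    (shift : ∀ a b, ρ (a + 2 * π) (b + 2 * π) ↔ ρ a b)
    (base : ∀ a b, -π ≤ a → a ≤ b → b ≤ π → ρ a b) {a b : ℝ} (hab : a ≤ b) : ρ a b := by
  have hshift : ∀ n : ℤ, ∀ a b, ρ (a + n * (2 * π)) (b + n * (2 * π)) ↔ ρ a b := by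
    intro n
    induction n using Int.induction_on with
    | zero => simp
    | succ i ih =>
      intro a b
      rw [← ih a b, ← shift (a + ((i : ℤ) : ℝ) * (2 * π))]
      push_cast
      ring_nf
    | pred i ih =>
      intro a b
      rw [← ih a b, ← shift (a + _)]
      push_cast
      ring_nf
  have hloc : ∀ n : ℤ, ∀ a b, -π + n * (2 * π) ≤ a → a ≤ b → b ≤ π + n * (2 * π) → ρ a b := by
    intro n a b h1 h2 h3
    have := (hshift n (a - n * (2 * π)) (b - n * (2 * π))).2
      (base _ _ (by linarith) (by linarith) (by linarith))
    simpa using this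
  obtain ⟨n, hn⟩ : ∃ n : ℤ, -π + n * (2 * π) ≤ a ∧ a ≤ π + n * (2 * π) := by
    refine ⟨toIocDiv Real.two_pi_pos (-π) a, ?_⟩
    have h1 := toIocMod_mem_Ioc Real.two_pi_pos (-π) a
    have h2 := toIocMod_add_toIocDiv_zsmul Real.two_pi_pos (-π) a
    rw [zsmul_eq_mul] at h2
    constructor <;> linarith [h1.1, h1.2]
  have hk : ∀ k : ℕ, ∀ b, a ≤ b → b ≤ π + ((n + k : ℤ) : ℝ) * (2 * π) → ρ a b := by
    intro k
    induction k with
    | zero => exact fun b h1 h2 => hloc n a b hn.1 h1 (by simpa using h2)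
    | succ k ih =>
      intro b h1 h2
      rcases le_or_gt b (π + ((n + k : ℤ) : ℝ) * (2 * π)) with h3 | h3
      · exact ih b h1 h3
      · refine trans _ (π + ((n + k : ℤ) : ℝ) * (2 * π)) _ (ih _ ?_ le_rfl)
          (hloc (n + (k + 1 : ℕ)) _ _ ?_ h3.le h2)
        · push_cast
          nlinarith [hn.2, Real.pi_pos, (Nat.cast_nonneg k : (0 : ℝ) ≤ k)]
        · push_cast
          linarith
  obtain ⟨k, hk'⟩ := exists_nat_gt ((b - π - n * (2 * π)) / (2 * π))
  refine hk k b hab ?_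
  rw [div_lt_iff₀ Real.two_pi_pos] at hk'
  push_cast
  linarith

/-- The extension of a function on a period to a function with constant increments `m` over
periods. -/
noncomputable def extendByPeriod {E : Type*} [AddCommGroup E] (f : ℝ → E) (m : E) (t : ℝ) : E :=
  f (toIocMod Real.two_pi_pos (-π) t) + toIocDiv Real.two_pi_pos (-π) t • m

section extendByPeriod

variable {E : Type*} [AddCommGroup E] {f : ℝ → E} {m : E}

theorem extendByPeriod_add (t : ℝ) :
    extendByPeriod f m (t + 2 * π) = extendByPeriod f m t + m := by
  rw [extendByPeriod, extendByPeriod, toIocMod_add_right, toIocDiv_add_right, add_zsmul, one_zsmul,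
    add_assoc]

/-- The extension reads `f` only on `(-π, π]`; the two boundary conditions make it agree at `-π` as
well. -/
theorem extendByPeriod_eq (h0 : f (-π) = 0) (h1 : f π = m) {t : ℝ} (ht : t ∈ Icc (-π) π) :
    extendByPeriod f m t = f t := by
  have hI : -π + 2 * π = π := by ring
  have hpos : ∀ s ∈ Ioc (-π) π, extendByPeriod f m s = f s := by
    intro s hs
    have e1 : toIocMod Real.two_pi_pos (-π) s = s := (toIocMod_eq_self _).2 (by rwa [hI])
    have e2 : toIocDiv Real.two_pi_pos (-π) s = 0 :=
      toIocDiv_eq_of_sub_zsmul_mem_Ioc _ (by rwa [hI, zero_smul, sub_zero])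
    rw [extendByPeriod, e1, e2, zero_smul, add_zero]
  rcases ht.1.eq_or_lt with h | h
  · have := extendByPeriod_add (f := f) (m := m) (-π)
    rw [hI, hpos π ⟨by linarith [Real.pi_pos], le_rfl⟩, h1] at this
    rw [← h, h0]
    exact left_eq_add.1 (by rwa [add_comm] at this)
  · exact hpos t ⟨h, ht.2⟩

end extendByPeriod

/-- `F` is the distribution function `t ↦ ν [-π, t)`, continued over periods. The analogous monotone
`G` made from the variation of `ν` dominates its increments, hence bounded variation; countable
additivity makes `F` left continuous, hence normalized. -/
theorem exists_dStieltjes_eq (ν : ComplexMeasure ℝ) [IsFiniteMeasure ν.variation]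
    (hν : ν.restrict (Ico (-π) π) = ν) :
    ∃ (F : ℝ → ℂ) (hF : IsBVCircle F), dStieltjes hF = ν := by
  have hpi := Real.pi_pos
  let F : ℝ → ℂ := extendByPeriod (fun t => ν (Ico (-π) t)) (ν (Ico (-π) π))
  let G : ℝ → ℝ := extendByPeriod (fun t => ν.variation.real (Ico (-π) t))
    (ν.variation.real (Ico (-π) π))
  have hF2 : ∀ t, F (t + 2 * π) = F t + ν (Ico (-π) π) := extendByPeriod_add
  have hG2 : ∀ t, G (t + 2 * π) = G t + ν.variation.real (Ico (-π) π) := extendByPeriod_add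
  have hF1 : ∀ t ∈ Icc (-π) π, F t = ν (Ico (-π) t) := fun t ht =>
    extendByPeriod_eq (by simp) rfl ht
  have hG1 : ∀ t ∈ Icc (-π) π, G t = ν.variation.real (Ico (-π) t) := fun t ht =>
    extendByPeriod_eq (by simp) rfl ht
  have hdiff : ∀ s t, -π ≤ s → s ≤ t → t ≤ π → F t - F s = ν (Ico s t) := by
    intro s t h1 h2 h3
    rw [hF1 s ⟨h1, h2.trans h3⟩, hF1 t ⟨h1.trans h2, h3⟩, ← Ico_union_Ico_eq_Ico h1 h2,
      VectorMeasure.of_union (Set.disjoint_left.2 fun z h1 h2 => absurd h1.2 (not_lt.2 h2.1))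
        measurableSet_Ico measurableSet_Ico]
    ring
  have hle : ∀ s t, s ≤ t → dist (F s) (F t) ≤ G t - G s := by
    intro s t hst
    refine of_periodic_of_trans (ρ := fun s t => dist (F s) (F t) ≤ G t - G s) ?_ ?_ ?_ hst
    · intro a b c h1 h2
      linarith [dist_triangle (F a) (F b) (F c)]
    · intro a b
      rw [hF2, hF2, hG2, hG2, dist_add_right, add_sub_add_right_eq_sub]
    · intro a b h1 h2 h3
      rw [dist_comm, dist_eq_norm, hdiff a b h1 h2 h3, hG1 a ⟨h1, h2.trans h3⟩,
        hG1 b ⟨h1.trans h2, h3⟩, ← Ico_union_Ico_eq_Ico h1 h2, measureReal_union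
        (Set.disjoint_left.2 fun z h1 h2 => absurd h1.2 (not_lt.2 h2.1)) measurableSet_Ico,
        add_sub_cancel_left]
      exact VectorMeasure.norm_measure_le_variation
  have hGmono : Monotone G := fun s t hst => by
    linarith [hle s t hst, dist_nonneg (x := F s) (y := F t)]
  have hBV : LocallyBoundedVariationOn F univ := fun a b ha hb =>
    ne_top_of_le_ne_top ((hGmono.monotoneOn univ).locallyBoundedVariationOn a b ha hb)
      (eVariationOn_le_of_dist_le fun x _ y _ hxy => hle x y hxy)
  have hleft0 : ∀ t ∈ Ioc (-π) π, Function.leftLim F t = F t := by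
    intro t ht
    obtain ⟨u, hu_mono, hu_lt, hu_lim⟩ := exists_seq_strictMono_tendsto' ht.1
    have hU : Ico (-π) t = ⋃ n, Ico (-π) (u n) := by
      ext x
      simp only [mem_Ico, mem_iUnion]
      constructor
      · rintro ⟨h1, h2⟩
        obtain ⟨n, hn⟩ := (hu_lim.eventually (lt_mem_nhds h2)).exists
        exact ⟨n, h1, hn⟩
      · rintro ⟨n, h1, h2⟩
        exact ⟨h1, h2.trans (hu_lt n).2⟩
    have h1 : Tendsto (fun n => F (u n)) atTop (𝓝 (F t)) := by
      rw [hF1 t ⟨ht.1.le, ht.2⟩, hU]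
      refine (ν.tendsto_vectorMeasure_iUnion_atTop_nat (fun i j hij =>
        Ico_subset_Ico_right (hu_mono.monotone hij)) fun n => measurableSet_Ico).congr fun n => ?_
      exact (hF1 _ ⟨(hu_lt n).1.le, (hu_lt n).2.le.trans ht.2⟩).symm
    have h2 : Tendsto u atTop (𝓝[<] t) :=
      tendsto_nhdsWithin_iff.2 ⟨hu_lim, Eventually.of_forall fun n => (hu_lt n).2⟩
    exact tendsto_nhds_unique ((tendsto_leftLim_of_locallyBV hBV t).comp h2) h1
  have hleft : ∀ t, Function.leftLim F t = F t := by
    -- The left jump is periodic, so left continuity on `(-π, π]` suffices.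
    have hper : Function.Periodic (fun t => Function.leftLim F t - F t) (2 * π) := fun t => by
      simp only [leftLim_add_period hBV hF2, hF2, add_sub_add_right_eq_sub]
    intro t
    have h1 := hper.sub_zsmul_eq (x := t) (toIocDiv Real.two_pi_pos (-π) t)
    rw [self_sub_toIocDiv_zsmul] at h1
    have h2 := toIocMod_mem_Ioc Real.two_pi_pos (-π) t
    rw [show -π + 2 * π = π by ring] at h2
    rw [hleft0 _ h2, sub_self] at h1
    exact sub_eq_zero.1 h1.symm
  have hF : IsBVCircle F :=
    { locallyBV := hBV
      periodic_increment := ⟨_, hF2⟩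
      normalized := fun t => by
        rw [hleft]
        exact left_mem_segment ℝ _ _ }
  refine ⟨F, hF, ext_of_Ico (dStieltjes_restrict hF) hν fun s t h1 h2 h3 => ?_⟩
  rw [dStieltjes_Ico hF h1 h2 h3, hleft, hleft, hdiff s t h1 h2 h3]

/-! ### Wrapping the line around the circle. -/

/-- The point of `[-π, π)` congruent to `-y` modulo `2π`. -/
noncomputable def reflectMod (y : ℝ) : ℝ :=
  (AddCircle.equivIco (2 * π) (-π) ((-y : ℝ) : AddCircle (2 * π)) : Ico (-π) (-π + 2 * π))

theorem measurable_reflectMod : Measurable reflectMod :=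
  measurable_subtype_coe.comp ((AddCircle.measurableEquivIco (2 * π) (-π)).measurable.comp
    (AddCircle.measurable_mk'.comp measurable_neg))

theorem reflectMod_mem (y : ℝ) : reflectMod y ∈ Ico (-π) π := by
  have h := (AddCircle.equivIco (2 * π) (-π) ((-y : ℝ) : AddCircle (2 * π))).2
  exact ⟨h.1, h.2.trans_eq (by ring)⟩

theorem exists_reflectMod_eq (y : ℝ) : ∃ n : ℤ, reflectMod y = -y + n * (2 * π) := by
  have h : ((reflectMod y : ℝ) : AddCircle (2 * π)) = ((-y : ℝ) : AddCircle (2 * π)) :=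
    AddCircle.coe_equivIco
  rw [← sub_eq_zero, ← AddCircle.coe_sub, AddCircle.coe_eq_zero_iff] at h
  obtain ⟨n, hn⟩ := h
  rw [zsmul_eq_mul] at hn
  exact ⟨n, by linarith⟩

/-- The multiple of `2π` is invisible because `k` is an integer; the reflection reconciles
`e^{-ikt}` in the coefficients with `e^{ixy}` in the transform. -/
theorem exp_reflectMod (k : ℤ) (y : ℝ) :
    Complex.exp (-(Complex.I * k * reflectMod y)) = Complex.exp (Complex.I * k * y) := by
  obtain ⟨n, hn⟩ := exists_reflectMod_eq y
  rw [hn, Complex.exp_eq_exp_iff_exists_int]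
  refine ⟨-(k * n), ?_⟩
  push_cast
  ring

theorem map_reflectMod_restrict (μ : ComplexMeasure ℝ) :
    (μ.map reflectMod).restrict (Ico (-π) π) = μ.map reflectMod := by
  ext s hs
  rw [VectorMeasure.restrict_apply _ measurableSet_Ico hs,
    VectorMeasure.map_apply _ measurable_reflectMod hs,
    VectorMeasure.map_apply _ measurable_reflectMod (hs.inter measurableSet_Ico), preimage_inter,
    inter_eq_left.2 (show reflectMod ⁻¹' s ⊆ reflectMod ⁻¹' Ico (-π) π from
      fun y _ => reflectMod_mem y)]

theorem integral_map_reflectMod (μ : ComplexMeasure ℝ) [IsFiniteMeasure μ.variation] (k : ℤ) :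
    (μ.map reflectMod).integral (fun t : ℝ => Complex.exp (-(Complex.I * k * t)))
      (ContinuousLinearMap.mul ℝ ℂ) = fourierStieltjes μ k := by
  rw [VectorMeasure.integral_map measurable_reflectMod (by fun_prop), fourierStieltjes]
  · simp_rw [exp_reflectMod]
    norm_cast
  · simp_rw [Function.comp_def, exp_reflectMod]
    exact_mod_cast integrable_exp_I μ.variation k

/-! ### Entire functions of exponential type. -/

/-- The zeros of `s` are simple and are zeros of `h`. Near such a zero `w` the quotient is `dslope h
w / dslope s w`, whose denominator does not vanish. -/
theorem exists_differentiable_quotient {h s : ℂ → ℂ} (hh : Differentiable ℂ h)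
    (hs : Differentiable ℂ s) (h0 : ∀ z, s z = 0 → h z = 0 ∧ deriv s z ≠ 0) :
    ∃ q : ℂ → ℂ, Differentiable ℂ q ∧ ∀ z, h z = q z * s z := by
  classical
  let q : ℂ → ℂ := fun z => if s z = 0 then deriv h z / deriv s z else h z / s z
  refine ⟨q, fun w => ?_, fun z => ?_⟩
  · by_cases hw : s w = 0
    · obtain ⟨hw1, hw2⟩ := h0 w hw
      have hd : ∀ {f : ℂ → ℂ}, Differentiable ℂ f → Differentiable ℂ (dslope f w) := fun hf =>
        differentiableOn_univ.1 ((Complex.differentiableOn_dslope univ_mem).2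
          hf.differentiableOn)
      have hsw : dslope s w w ≠ 0 := by rwa [dslope_same]
      have hev : q =ᶠ[𝓝 w] fun z => dslope h w z / dslope s w z := by
        filter_upwards [(hd hs).continuous.continuousAt.eventually_ne hsw] with z hz
        by_cases hzw : z = w
        · subst hzw
          simp [q, hw]
        · have e1 := sub_smul_dslope h w z
          have e2 := sub_smul_dslope s w z
          rw [hw1, sub_zero, smul_eq_mul] at e1
          rw [hw, sub_zero, smul_eq_mul] at e2
          have hzw' : z - w ≠ 0 := sub_ne_zero.2 hzw
          have hsz : s z ≠ 0 := by
            rw [← e2]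
            exact mul_ne_zero hzw' hz
          simp only [q, if_neg hsz]
          rw [← e1, ← e2, mul_div_mul_left _ _ hzw']
      exact (((hd hh) w).div ((hd hs) w) hsw).congr_of_eventuallyEq hev
    · have hev : q =ᶠ[𝓝 w] fun z => h z / s z := by
        filter_upwards [hs.continuous.continuousAt.eventually_ne hw] with z hz
        simp only [q, if_neg hz]
      exact ((hh w).div (hs w) hw).congr_of_eventuallyEq hev
  · by_cases hz : s z = 0
    · rw [hz, (h0 z hz).1, mul_zero]
    · simp only [q, if_neg hz]
      rw [div_mul_cancel₀ _ hz]

/-- Phragmén–Lindelöf, applied after damping `h` by an exponential of rate `σ + ε`; then `ε` tends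
to `0`. -/
theorem norm_le_of_expType_of_nonneg_im {σ M : ℝ} {h : ℂ → ℂ} (hh : IsEntireOfExpType σ h)
    (hM : ∀ x : ℝ, ‖h x‖ ≤ M) {z : ℂ} (hz : 0 ≤ z.im) : ‖h z‖ ≤ M * Real.exp (σ * z.im) := by
  have key : ∀ ε > 0, ‖h z‖ ≤ M * Real.exp ((σ + ε) * z.im) := by
    intro ε hε
    obtain ⟨C, hC⟩ := hh.2 ε hε
    -- Multiplication by `i` carries the right half-plane to the upper one: `f` is bounded by `C` on
    -- the positive axis, and by `M` on the imaginary axis, where the factor has modulus one.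
    let f : ℂ → ℂ := fun w => h (Complex.I * w) * Complex.exp (-((σ + ε : ℝ) : ℂ) * w)
    have hexp : ∀ w : ℂ, ‖Complex.exp (-((σ + ε : ℝ) : ℂ) * w)‖ = Real.exp (-(σ + ε) * w.re) := by
      intro w
      rw [Complex.norm_exp, ← Complex.ofReal_neg, Complex.re_ofReal_mul]
    have hfC : ∀ w : ℂ, ‖f w‖ ≤ C * Real.exp ((σ + ε) * ‖w‖) * Real.exp (-(σ + ε) * w.re) := by
      intro w
      rw [norm_mul, hexp]
      refine mul_le_mul_of_nonneg_right ?_ (Real.exp_pos _).le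
      simpa using hC (Complex.I * w)
    have hC0 : 0 ≤ C := by
      have := (norm_nonneg _).trans (hC 0)
      simpa using this
    have hmain := PhragmenLindelof.right_half_plane_of_bounded_on_real (f := f) (C := M)
      (z := -Complex.I * z) ?_ ?_ ?_ ?_ ?_
    · have e1 : Complex.I * (-Complex.I * z) = z := by
        rw [← mul_assoc, mul_neg, Complex.I_mul_I, neg_neg, one_mul]
      have e2 : (-Complex.I * z).re = z.im := by simp
      simp only [f] at hmain
      rw [e1, norm_mul, hexp, e2] at hmain
      rw [neg_mul, Real.exp_neg, ← div_eq_mul_inv, div_le_iff₀ (Real.exp_pos _)] at hmain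
      exact hmain
    · refine Differentiable.diffContOnCl ?_
      exact (hh.1.comp (differentiable_id.const_mul _)).mul
        (Complex.differentiable_exp.comp (differentiable_id.const_mul _))
    · refine ⟨1, one_lt_two, (σ + ε) + |σ + ε|, Asymptotics.IsBigO.of_bound C
        (Eventually.of_forall fun w => (hfC w).trans ?_)⟩
      rw [Real.norm_of_nonneg (Real.exp_pos _).le, mul_assoc, ← Real.exp_add, Real.rpow_one]
      refine mul_le_mul_of_nonneg_left (Real.exp_le_exp.2 ?_) hC0
      have h1 : -(σ + ε) * w.re ≤ |σ + ε| * ‖w‖ :=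
        (le_abs_self _).trans (by
          rw [abs_mul, abs_neg]
          exact mul_le_mul_of_nonneg_left (Complex.abs_re_le_norm w) (abs_nonneg _))
      linarith
    · refine isBoundedUnder_of_eventually_le (a := C) ?_
      filter_upwards [eventually_ge_atTop 0] with x hx
      refine (hfC x).trans ?_
      rw [Complex.norm_of_nonneg hx, Complex.ofReal_re, mul_assoc, ← Real.exp_add, neg_mul, add_neg_cancel,
        Real.exp_zero, mul_one]
    · intro x
      simp only [f]
      rw [norm_mul, hexp]
      have : Complex.I * (x * Complex.I) = ((-x : ℝ) : ℂ) := by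
        push_cast
        linear_combination (x : ℂ) * Complex.I_mul_I
      rw [this]
      simpa using hM (-x)
    · simpa using hz
  have hlim : Tendsto (fun ε : ℝ => M * Real.exp ((σ + ε) * z.im)) (𝓝[>] 0)
      (𝓝 (M * Real.exp ((σ + 0) * z.im))) :=
    (Continuous.tendsto (by fun_prop) 0).mono_left nhdsWithin_le_nhds
  rw [add_zero] at hlim
  exact ge_of_tendsto hlim (eventually_mem_nhdsWithin.mono fun ε hε => key ε hε)

theorem norm_le_of_expType {σ M : ℝ} {h : ℂ → ℂ} (hh : IsEntireOfExpType σ h)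
    (hM : ∀ x : ℝ, ‖h x‖ ≤ M) (z : ℂ) : ‖h z‖ ≤ M * Real.exp (σ * |z.im|) := by
  rcases le_total 0 z.im with hz | hz
  · rw [abs_of_nonneg hz]
    exact norm_le_of_expType_of_nonneg_im hh hM hz
  · have hneg : IsEntireOfExpType σ fun z => h (-z) :=
      ⟨hh.1.comp differentiable_neg, fun ε hε => by
        obtain ⟨C, hC⟩ := hh.2 ε hε
        exact ⟨C, fun z => by simpa using hC (-z)⟩⟩
    have := norm_le_of_expType_of_nonneg_im (M := M) (z := -z) hneg
      (fun x => by simpa using hM (-x)) (by simpa using hz)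
    rw [abs_of_nonpos hz]
    simpa using this

/-- With `E = exp (π |Im z|)`, `|sin πz| ≥ (E - 1/E) / 2`, and `E ≥ 2` makes this at least `E / 4`.
-/
theorem exp_le_norm_sin_of_one_le_abs_im {z : ℂ} (hz : 1 ≤ |z.im|) :
    Real.exp (π * |z.im|) ≤ 4 * ‖Complex.sin (π * z)‖ := by
  have hn : ‖Complex.sin (π * z)‖ =
      ‖Complex.exp (-(π * z) * Complex.I) - Complex.exp (π * z * Complex.I)‖ / 2 := by
    rw [Complex.sin, norm_div, norm_mul, Complex.norm_I, mul_one, Complex.norm_two]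
  have e1 : ‖Complex.exp (-(π * z) * Complex.I)‖ = Real.exp (π * z.im) := by
    rw [Complex.norm_exp]; simp
  have e2 : ‖Complex.exp (π * z * Complex.I)‖ = Real.exp (-(π * z.im)) := by
    rw [Complex.norm_exp]; simp
  have h1 := abs_norm_sub_norm_le (Complex.exp (-(π * z) * Complex.I))
    (Complex.exp (π * z * Complex.I))
  rw [e1, e2] at h1
  have h2 : Real.exp (π * |z.im|) - Real.exp (-(π * |z.im|)) ≤
      |Real.exp (π * z.im) - Real.exp (-(π * z.im))| := by
    rcases le_total 0 z.im with h | h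
    · rw [abs_of_nonneg h]; exact le_abs_self _
    · rw [abs_of_nonpos h, abs_sub_comm, mul_neg, neg_neg]; exact le_abs_self _
  have h3 : Real.exp (-(π * |z.im|)) ≤ 1 := by
    rw [Real.exp_le_one_iff]
    nlinarith [Real.pi_pos]
  have h4 : 2 ≤ Real.exp (π * |z.im|) := by
    have := Real.add_one_le_exp (π * |z.im|)
    nlinarith [Real.pi_gt_three]
  rw [hn]
  linarith

/-- On these vertical lines `|sin πz| = cosh (π Im z)`. -/
theorem exp_le_norm_sin_of_re_eq {z : ℂ} {n : ℤ} (hz : z.re = n + 1 / 2) :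
    Real.exp (π * |z.im|) ≤ 4 * ‖Complex.sin (π * z)‖ := by
  have e : (π : ℂ) * z = (π * z.im : ℝ) * Complex.I + (π / 2 : ℝ) + n * π := by
    conv_lhs => rw [← Complex.re_add_im z, hz]
    push_cast
    ring
  have h1 : ‖Complex.sin (π * z)‖ = Real.cosh (π * z.im) := by
    have hper : Function.Periodic (fun w : ℂ => ‖Complex.sin w‖) π := fun w => by
      simp only [Complex.sin_add_pi, norm_neg]
    have h2 := hper.int_mul n ((π * z.im : ℝ) * Complex.I + (π / 2 : ℝ))
    rw [e, h2, Complex.ofReal_div, Complex.ofReal_ofNat,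
      Complex.sin_add_pi_div_two, Complex.cos_mul_I, ← Complex.ofReal_cosh,
      Complex.norm_of_nonneg (Real.cosh_pos _).le]
  rw [h1, ← Real.cosh_abs, abs_mul, abs_of_pos Real.pi_pos, Real.cosh_eq]
  linarith [Real.exp_pos (π * |z.im|), Real.exp_pos (-(π * |z.im|))]

/-- An entire function of exponential type at most `π` that is bounded on the real line and
vanishes at the integers is a multiple of `sin πz`. -/
theorem exists_eq_mul_sin {M : ℝ} {h : ℂ → ℂ} (hh : IsEntireOfExpType π h)
    (hM : ∀ x : ℝ, ‖h x‖ ≤ M) (h0 : ∀ k : ℤ, h k = 0) :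
    ∃ l : ℂ, ∀ z, h z = l * Complex.sin (π * z) := by
  have hpi : (π : ℂ) ≠ 0 := by exact_mod_cast Real.pi_ne_zero
  have hM0 : 0 ≤ M := (norm_nonneg _).trans (hM 0)
  have hs : ∀ z : ℂ, HasDerivAt (fun z : ℂ => Complex.sin (π * z)) (Complex.cos (π * z) * π) z :=
    fun z => (Complex.hasDerivAt_sin _).comp z (by simpa using (hasDerivAt_id z).const_mul (π : ℂ))
  obtain ⟨q, hq, hqs⟩ := exists_differentiable_quotient hh.1
    (fun z => (hs z).differentiableAt) (fun z hz => by
      obtain ⟨k, hk⟩ := Complex.sin_eq_zero_iff.1 hz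
      have hzk : z = k := mul_left_cancel₀ hpi (by rw [hk, mul_comm])
      refine ⟨hzk ▸ h0 k, ?_⟩
      rw [(hs z).deriv]
      refine mul_ne_zero (fun hc => ?_) hpi
      have := Complex.sin_sq_add_cos_sq (π * z)
      rw [hz, hc] at this
      simp at this)
  have hbd : ∀ z : ℂ, Real.exp (π * |z.im|) ≤ 4 * ‖Complex.sin (π * z)‖ → ‖q z‖ ≤ 4 * M := by
    intro z hz
    have h1 := norm_le_of_expType hh hM z
    rw [hqs, norm_mul] at h1
    have hpos : 0 < ‖Complex.sin (π * z)‖ := by linarith [Real.exp_pos (π * |z.im|)]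
    refine le_of_mul_le_mul_right ?_ hpos
    nlinarith
  have hall : ∀ z : ℂ, ‖q z‖ ≤ 4 * M := by
    intro z
    rcases le_or_gt 1 |z.im| with h1 | h1
    · exact hbd z (exp_le_norm_sin_of_one_le_abs_im h1)
    -- Inside the strip, `z` lies in a rectangle with vertical sides at consecutive half-integers
    -- and horizontal sides at height `±1`. The lower bounds for the sine hold on its whole
    -- boundary, and the maximum principle applies.
    · set n := ⌊z.re - 1 / 2⌋ with hn
      have hlt : (n : ℝ) + 1 / 2 < n + 1 + 1 / 2 := by linarith
      have hbnd : Bornology.IsBounded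
          (Ioo ((n : ℝ) + 1 / 2) (n + 1 + 1 / 2) ×ℂ Ioo (-1) 1) :=
        (Metric.isBounded_Ioo _ _).reProdIm (Metric.isBounded_Ioo _ _)
      refine Complex.norm_le_of_forall_mem_frontier_norm_le hbnd hq.diffContOnCl (fun w hw => ?_) ?_
      · rw [Complex.frontier_reProdIm, frontier_Ioo hlt, frontier_Ioo (by norm_num)] at hw
        rcases hw with hw | hw
        · refine hbd w (exp_le_norm_sin_of_one_le_abs_im ?_)
          rcases hw.2 with h2 | h2 <;> (rw [show w.im = _ from h2]; norm_num)
        · rcases hw.1 with h2 | h2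
          · exact hbd w (exp_le_norm_sin_of_re_eq (n := n) h2)
          · exact hbd w (exp_le_norm_sin_of_re_eq (n := n + 1) (by rw [show w.re = _ from h2]; simp))
      · rw [Complex.closure_reProdIm, closure_Ioo hlt.ne, closure_Ioo (by norm_num)]
        have h2 := Int.floor_le (z.re - 1 / 2)
        have h3 := Int.lt_floor_add_one (z.re - 1 / 2)
        have h4 := abs_lt.1 h1
        exact ⟨⟨by linarith, by linarith⟩, ⟨h4.1.le, h4.2.le⟩⟩
  have hrange : Bornology.IsBounded (range q) := by
    refine (Metric.isBounded_closedBall (x := (0 : ℂ)) (r := 4 * M)).subset ?_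
    rintro _ ⟨z, rfl⟩
    simpa using hall z
  exact ⟨q 0, fun z => by rw [hqs, hq.apply_eq_apply_of_bounded hrange z 0]⟩

/-- The easy direction of Paley–Wiener: for `|t| ≤ σ` the kernel is at most `exp (σ ‖z‖)`, which
also justifies differentiation under the integral. -/
theorem isEntireOfExpType_integral {m : Measure ℝ} {h : ℝ → ℂ} (hh : Integrable h m) {σ : ℝ}
    (hm : ∀ᵐ t ∂m, |t| ≤ σ) :
    IsEntireOfExpType σ fun z => ∫ t : ℝ, Complex.exp (-(Complex.I * z * t)) * h t ∂m := by
  have hnorm : ∀ (z : ℂ) (t : ℝ), |t| ≤ σ →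
      ‖Complex.exp (-(Complex.I * z * t))‖ ≤ Real.exp (σ * ‖z‖) := by
    intro z t ht
    rw [Complex.norm_exp]
    refine Real.exp_le_exp.2 ((Complex.re_le_norm _).trans ?_)
    rw [norm_neg, norm_mul, norm_mul, Complex.norm_I, one_mul, Complex.norm_real, Real.norm_eq_abs,
      mul_comm]
    exact mul_le_mul_of_nonneg_right ht (norm_nonneg _)
  have hmeas : ∀ z : ℂ, AEStronglyMeasurable
      (fun t : ℝ => Complex.exp (-(Complex.I * z * t)) * h t) m := fun z =>
    AEStronglyMeasurable.mul (Continuous.aestronglyMeasurable (by fun_prop)) hh.1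
  have hint : ∀ z : ℂ, Integrable (fun t : ℝ => Complex.exp (-(Complex.I * z * t)) * h t) m := by
    intro z
    refine (hh.norm.const_mul (Real.exp (σ * ‖z‖))).mono' (hmeas z) ?_
    filter_upwards [hm] with t ht
    rw [norm_mul]
    exact mul_le_mul_of_nonneg_right (hnorm z t ht) (norm_nonneg _)
  refine ⟨fun z => ?_, fun ε hε => ⟨∫ t, ‖h t‖ ∂m, fun z => ?_⟩⟩
  · refine (hasDerivAt_integral_of_dominated_loc_of_deriv_le (Metric.ball_mem_nhds z one_pos)
      (F' := fun z (t : ℝ) => Complex.exp (-(Complex.I * z * t)) * -(Complex.I * t) * h t)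
      (bound := fun t => Real.exp (|σ| * (‖z‖ + 1)) * |σ| * ‖h t‖)
      (Eventually.of_forall hmeas) (hint z) ?_ ?_ ?_ ?_).2.differentiableAt
    · exact AEStronglyMeasurable.mul (Continuous.aestronglyMeasurable (by fun_prop)) hh.1
    · filter_upwards [hm] with t ht w hw
      rw [norm_mul, norm_mul, norm_neg, norm_mul, Complex.norm_I, one_mul, Complex.norm_real,
        Real.norm_eq_abs]
      refine mul_le_mul_of_nonneg_right (mul_le_mul ((hnorm w t ht).trans (Real.exp_le_exp.2 ?_))
        (ht.trans (le_abs_self _)) (abs_nonneg _) (Real.exp_pos _).le) (norm_nonneg _)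
      refine mul_le_mul (le_abs_self _) ?_ (norm_nonneg _) (abs_nonneg _)
      have h1 := norm_sub_norm_le w z
      rw [mem_ball_iff_norm] at hw
      linarith
    · exact hh.norm.const_mul _
    · refine Eventually.of_forall fun t w _ => ?_
      have h1 : HasDerivAt (fun w : ℂ => -(Complex.I * w * t)) (-(Complex.I * t)) w := by
        have := (((hasDerivAt_id w).const_mul Complex.I).mul_const (t : ℂ)).neg
        rw [mul_one] at this
        exact this
      exact h1.cexp.mul_const _
  · have h1 : ‖∫ t : ℝ, Complex.exp (-(Complex.I * z * t)) * h t ∂m‖ ≤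
        ∫ t, Real.exp (σ * ‖z‖) * ‖h t‖ ∂m := by
      refine norm_integral_le_of_norm_le (hh.norm.const_mul _) ?_
      filter_upwards [hm] with t ht
      rw [norm_mul]
      exact mul_le_mul_of_nonneg_right (hnorm z t ht) (norm_nonneg _)
    refine h1.trans ?_
    rw [integral_const_mul, mul_comm]
    refine mul_le_mul_of_nonneg_left (Real.exp_le_exp.2 ?_)
      (integral_nonneg fun t => norm_nonneg _)
    exact mul_le_mul_of_nonneg_right (by linarith) (norm_nonneg _)

theorem isEntireOfExpType_add_mul_sin {g : ℂ → ℂ} (hg : IsEntireOfExpType π g) (l : ℂ) :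
    IsEntireOfExpType π fun z => g z + l * Complex.sin (π * z) := by
  refine ⟨hg.1.add ((Complex.differentiable_sin.comp (differentiable_id.const_mul _)).const_mul _),
    fun ε hε => ?_⟩
  obtain ⟨C, hC⟩ := hg.2 ε hε
  refine ⟨C + ‖l‖, fun z => (norm_add_le _ _).trans ?_⟩
  have hsin : ‖Complex.sin (π * z)‖ ≤ Real.exp ((π + ε) * ‖z‖) := by
    have e : ∀ w : ℂ, ‖w‖ = ‖z‖ → ‖Complex.exp (π * w)‖ ≤ Real.exp ((π + ε) * ‖z‖) := fun w hw => by
      rw [Complex.norm_exp, Complex.re_ofReal_mul]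
      refine Real.exp_le_exp.2 ?_
      have := Complex.re_le_norm w
      rw [hw] at this
      nlinarith [Real.pi_pos, norm_nonneg z]
    have e1 := e (-z * Complex.I) (by simp)
    have e2 := e (z * Complex.I) (by simp)
    have h1 := norm_sub_le (Complex.exp (π * (-z * Complex.I))) (Complex.exp (π * (z * Complex.I)))
    have hn : ‖Complex.sin (π * z)‖ =
        ‖Complex.exp (π * (-z * Complex.I)) - Complex.exp (π * (z * Complex.I))‖ / 2 := by
      rw [Complex.sin, norm_div, norm_mul, Complex.norm_I, mul_one, Complex.norm_two]
      ring_nf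
    rw [hn]
    linarith
  rw [norm_mul, add_mul]
  exact add_le_add (hC z) (mul_le_mul_of_nonneg_left hsin (norm_nonneg _))

theorem isEntireOfExpType_sub {σ : ℝ} {f g : ℂ → ℂ} (hf : IsEntireOfExpType σ f)
    (hg : IsEntireOfExpType σ g) : IsEntireOfExpType σ fun z => f z - g z := by
  refine ⟨hf.1.sub hg.1, fun ε hε => ?_⟩
  obtain ⟨C, hC⟩ := hf.2 ε hε
  obtain ⟨D, hD⟩ := hg.2 ε hε
  refine ⟨C + D, fun z => (norm_sub_le _ _).trans ?_⟩
  rw [add_mul]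
  exact add_le_add (hC z) (hD z)

/-! ### Increasing functions and positive measures. -/

theorem isFiniteMeasure_variation_withDensityᵥ {X : Type*} [MeasurableSpace X] {m : Measure X}
    {h : X → ℂ} (hh : Integrable h m) : IsFiniteMeasure (m.withDensityᵥ h).variation := by
  rw [Measure.variation_withDensityᵥ hh]
  exact isFiniteMeasure_withDensity hh.2.ne

theorem withDensityᵥ_restrict {X : Type*} [MeasurableSpace X] {m : Measure X} {h : X → ℂ}
    (hh : Integrable h m) {I : Set X} (hI : MeasurableSet I) (hm : ∀ᵐ x ∂m, x ∈ I) :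
    (m.withDensityᵥ h).restrict I = m.withDensityᵥ h := by
  ext E hE
  rw [VectorMeasure.restrict_apply _ hI hE, withDensityᵥ_apply hh (hE.inter hI),
    withDensityᵥ_apply hh hE]
  refine setIntegral_congr_set ?_
  filter_upwards [hm] with x hx
  simp only [eq_iff_iff]
  exact and_iff_left hx

/-- `F` is a monotone real function plus an imaginary constant, so `m` is the ordinary Stieltjes
measure of its real part. Density `1` turns a positive measure into a complex one. -/
theorem exists_measure_of_isIncreasing (hF : IsBVCircle F) (h : IsIncreasing F) :
    ∃ m : Measure ℝ, IsFiniteMeasure m ∧ dStieltjes hF = m.withDensityᵥ fun _ => (1 : ℂ) := by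
  let G : ℝ → ℝ := fun t => (F t).re
  have hG : Monotone G := fun s t hst => by
    have := (h s t hst).1
    rwa [Complex.sub_re, sub_nonneg] at this
  have him : ∀ t, (F t).im = (F 0).im := fun t => by
    rcases le_total 0 t with h0 | h0
    · have := (h _ _ h0).2
      rwa [Complex.sub_im, sub_eq_zero] at this
    · have := (h _ _ h0).2
      rw [Complex.sub_im, sub_eq_zero] at this
      exact this.symm
  have hleft : ∀ t, Function.leftLim F t = Function.leftLim G t + (F 0).im * Complex.I := by
    intro t
    refine leftLim_eq_of_tendsto ?_
    have h1 : Tendsto (fun s => ((G s : ℝ) : ℂ) + (F 0).im * Complex.I) (𝓝[<] t)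
        (𝓝 (Function.leftLim G t + (F 0).im * Complex.I)) :=
      ((Complex.continuous_ofReal.tendsto _).comp (hG.tendsto_leftLim t)).add_const _
    refine h1.congr fun s => ?_
    rw [← him s]
    exact Complex.re_add_im (F s)
  have hlr : ∀ t, Function.leftLim hG.stieltjesFunction t = Function.leftLim G t := fun t =>
    leftLim_rightLim (hG.tendsto_leftLim t)
  let m : Measure ℝ := hG.stieltjesFunction.measure.restrict (Ico (-π) π)
  have hm : IsFiniteMeasure m := ⟨by
    rw [Measure.restrict_apply_univ, StieltjesFunction.measure_Ico]
    exact ENNReal.ofReal_lt_top⟩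
  have hint : Integrable (fun _ => (1 : ℂ)) m := integrable_const _
  refine ⟨m, hm, ext_of_Ico (dStieltjes_restrict hF) (withDensityᵥ_restrict hint measurableSet_Ico
    (ae_restrict_mem measurableSet_Ico)) fun s t h1 h2 h3 => ?_⟩
  have hmono : Function.leftLim G s ≤ Function.leftLim G t := hG.leftLim h2
  rw [dStieltjes_Ico hF h1 h2 h3, hleft, hleft, withDensityᵥ_apply hint measurableSet_Ico,
    setIntegral_const, measureReal_def, Measure.restrict_apply measurableSet_Ico,
    inter_eq_left.2 (Ico_subset_Ico h1 h3), StieltjesFunction.measure_Ico, hlr, hlr,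
    ENNReal.toReal_ofReal (sub_nonneg.2 hmono)]
  simp

/-- An increment splits into a right jump, the mass of an open interval and a left jump. The
normalization makes each half-jump a fraction in `[0, 1]` of a nonnegative atom. -/
theorem isIncreasing_of_measure (hF : IsBVCircle F) {m : Measure ℝ} [IsFiniteMeasure m]
    (hm : dStieltjes hF = m.withDensityᵥ fun _ => (1 : ℂ)) : IsIncreasing F := by
  have hpi := Real.pi_pos
  obtain ⟨c, hc⟩ := hF.periodic_increment
  have hpos : ∀ E, MeasurableSet E → ∃ r : ℝ, 0 ≤ r ∧ dStieltjes hF E = r := fun E hE => by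
    refine ⟨m.real E, measureReal_nonneg, ?_⟩
    rw [hm, withDensityᵥ_apply (integrable_const _) hE, setIntegral_const]
    simp
  have hjump : ∀ a, -π ≤ a → a < π → ∃ r s : ℝ, 0 ≤ r ∧ 0 ≤ s ∧ F a - Function.leftLim F a = r ∧
      Function.rightLim F a - F a = s := by
    intro a ha1 ha2
    obtain ⟨r, hr, hr'⟩ := hpos {a} (measurableSet_singleton a)
    rw [dStieltjes_singleton hF ha1 ha2] at hr'
    have hseg := hF.normalized a
    rw [segment_eq_image'] at hseg
    obtain ⟨θ, ⟨hθ0, hθ1⟩, hθ⟩ := hseg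
    dsimp only at hθ
    rw [hr', Complex.real_smul] at hθ
    refine ⟨θ * r, (1 - θ) * r, by positivity, mul_nonneg (by linarith) hr, ?_, ?_⟩
    · rw [← hθ]; push_cast; ring
    · push_cast
      linear_combination hr' + hθ
  have hleft : ∀ a, -π ≤ a → a ≤ π → ∃ r : ℝ, 0 ≤ r ∧ F a - Function.leftLim F a = r := by
    intro a ha1 ha2
    rcases ha2.eq_or_lt with rfl | h
    -- `π` is outside the period, but its left jump equals that at `-π`.
    · obtain ⟨r, s, hr, -, hr', -⟩ := hjump (-π) le_rfl (by linarith)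
      refine ⟨r, hr, ?_⟩
      have e1 := hc (-π)
      have e2 := leftLim_add_period hF.locallyBV hc (-π)
      rw [show -π + 2 * π = π by ring] at e1 e2
      rw [e1, e2, ← hr']; ring
    · obtain ⟨r, s, hr, -, hr', -⟩ := hjump a ha1 h
      exact ⟨r, hr, hr'⟩
  intro s t hst
  refine of_periodic_of_trans (ρ := fun s t => 0 ≤ (F t - F s).re ∧ (F t - F s).im = 0)
    ?_ ?_ ?_ hst
  · rintro x y z ⟨h1, h2⟩ ⟨h3, h4⟩
    simp only [Complex.sub_re, Complex.sub_im] at *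
    constructor <;> linarith
  · intro x y
    rw [hc, hc, add_sub_add_right_eq_sub]
  · intro x y hx hxy hy
    rcases hxy.eq_or_lt with rfl | hlt
    · simp
    obtain ⟨r1, h1, e1⟩ := hleft y (hx.trans hxy) hy
    obtain ⟨-, r2, -, h2, -, e2⟩ := hjump x hx (hlt.trans_le hy)
    obtain ⟨r3, h3, e3⟩ := hpos (Ioo x y) measurableSet_Ioo
    rw [dStieltjes_Ioo hF hx hlt hy] at e3
    have e : F y - F x = ((r1 + r2 + r3 : ℝ) : ℂ) := by
      push_cast
      rw [← e1, ← e2, ← e3]; ring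
    rw [e, Complex.ofReal_re, Complex.ofReal_im]
    exact ⟨by positivity, rfl⟩

/-! ### The class `W`, the extension `φ₀` and the minimal norm. -/

theorem Represents.isFiniteMeasure {μ : ComplexMeasure ℝ} {φ : ℝ → ℂ} (h : Represents μ φ) :
    IsFiniteMeasure μ.variation := ⟨h.1⟩

theorem Represents.add {μ ν : ComplexMeasure ℝ} {φ ψ : ℝ → ℂ} (h1 : Represents μ φ)
    (h2 : Represents ν ψ) : Represents (μ + ν) (φ + ψ) := by
  have := h1.isFiniteMeasure
  have := h2.isFiniteMeasure
  refine ⟨(VectorMeasure.variation_add_le univ).trans_lt (ENNReal.add_lt_top.2 ⟨h1.1, h2.1⟩),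
    fun x => ?_⟩
  rw [fourierStieltjes, VectorMeasure.integral_add_vectorMeasure (integrable_exp_I _ _)
    (integrable_exp_I _ _), Pi.add_apply, h1.2, h2.2]
  rfl

theorem Represents.bounded {μ : ComplexMeasure ℝ} {φ : ℝ → ℂ} (h : Represents μ φ) :
    ∃ M, ∀ x, ‖φ x‖ ≤ M := by
  have := h.isFiniteMeasure
  refine ⟨‖ContinuousLinearMap.mul ℝ ℂ‖ * ∫ _, (1 : ℝ) ∂μ.variation, fun x => ?_⟩
  rw [h.2]
  refine VectorMeasure.norm_integral_le_integral_norm.trans (le_of_eq ?_)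
  simp_rw [norm_exp_I]

theorem represents_dirac (a : ℝ) (c : ℂ) :
    Represents (VectorMeasure.dirac a c) fun x => Complex.exp (Complex.I * x * a) * c := by
  refine ⟨measure_lt_top _ _, fun x => ?_⟩
  rw [fourierStieltjes, VectorMeasure.integral_dirac]
  rfl

/-- Opposite point masses at `±π`, by Euler's formula; on the circle they fall on one point and
cancel. -/
theorem mul_sin_mem_W (l : ℂ) : (fun x : ℝ => l * Real.sin (π * x)) ∈ W := by
  have h := (represents_dirac (-π) (l * Complex.I / 2)).add (represents_dirac π (-(l * Complex.I / 2)))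
  refine ⟨_, h.1, fun x => ?_⟩
  rw [← h.2, Pi.add_apply]
  dsimp only
  rw [Complex.ofReal_sin, Complex.sin]
  push_cast
  ring_nf

theorem add_mem_W {φ ψ : ℝ → ℂ} (h1 : φ ∈ W) (h2 : ψ ∈ W) : φ + ψ ∈ W := by
  obtain ⟨μ, hμ⟩ := h1
  obtain ⟨ν, hν⟩ := h2
  exact ⟨_, hμ.add hν⟩

theorem represents_phi₀ (hF : IsBVCircle F) :
    Represents ((dStieltjes hF).map fun t => -t) (phi₀ hF) := by
  refine ⟨measure_lt_top _ _, fun x => ?_⟩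
  have hfun : ∀ t : ℝ, Complex.exp (Complex.I * x * ((-t : ℝ) : ℂ)) =
      Complex.exp (-(Complex.I * x * t)) := fun t => by
    congr 1
    push_cast
    ring
  rw [fourierStieltjes, VectorMeasure.integral_map measurable_neg (by fun_prop), phi₀]
  · simp_rw [hfun]
  · simp_rw [Function.comp_def, hfun]
    exact integrable_exp_neg_I _ x

theorem phi₀_extends (hF : IsBVCircle F) {c : ℤ → ℂ} (hc : IsFourierStieltjesSeries c hF) :
    Extends (phi₀ hF) c := by
  intro k
  rw [hc k, phi₀]
  norm_cast

theorem phi₀_eq_integral (hF : IsBVCircle F) {m : Measure ℝ} {h : ℝ → ℂ} (hh : Integrable h m)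
    (e : dStieltjes hF = m.withDensityᵥ h) (x : ℝ) :
    phi₀ hF x = ∫ t : ℝ, Complex.exp (-(Complex.I * x * t)) * h t ∂m := by
  have := isFiniteMeasure_variation_withDensityᵥ hh
  rw [phi₀, e, integral_withDensityᵥ hh (integrable_exp_neg_I _ x)]

theorem exists_entire_phi₀ (hF : IsBVCircle F) :
    ∃ g : ℂ → ℂ, IsEntireOfExpType π g ∧ ∀ x : ℝ, g x = phi₀ hF x := by
  obtain ⟨h, hh, e⟩ := exists_variation_withDensityᵥ_eq (dStieltjes hF)
  refine ⟨_, isEntireOfExpType_integral hh ?_, fun x => (phi₀_eq_integral hF hh e x).symm⟩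
  have : ∀ᵐ t ∂(dStieltjes hF).variation, t ∈ Ico (-π) π := by
    rw [← dStieltjes_restrict hF, VectorMeasure.variation_restrict measurableSet_Ico]
    exact ae_restrict_mem measurableSet_Ico
  filter_upwards [this] with t ht
  exact abs_le.2 ⟨ht.1, ht.2.le⟩

/-- `dF` is determined by any complex measure on the line whose Fourier transform extends the
coefficients. -/
theorem dStieltjes_eq_map (hF : IsBVCircle F) {c : ℤ → ℂ} (hc : IsFourierStieltjesSeries c hF)
    {μ : ComplexMeasure ℝ} {φ : ℝ → ℂ} (h : Represents μ φ) (hφ : Extends φ c) :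
    dStieltjes hF = μ.map reflectMod := by
  have := h.isFiniteMeasure
  refine eq_of_coeff_eq (dStieltjes_restrict hF) (map_reflectMod_restrict μ) fun k => ?_
  rw [← hc k, integral_map_reflectMod, ← h.2, hφ]

/-- A push-forward does not increase total variation. The bound holds for every representing
measure, so `wNorm` can be handled without uniqueness of that measure. -/
theorem totalVar_le (hF : IsBVCircle F) {c : ℤ → ℂ} (hc : IsFourierStieltjesSeries c hF)
    {μ : ComplexMeasure ℝ} {φ : ℝ → ℂ} (h : Represents μ φ) (hφ : Extends φ c) :
    totalVar F ≤ (μ.variation univ).toReal := by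
  have := h.isFiniteMeasure
  rw [totalVar_eq hF, dStieltjes_eq_map hF hc h hφ]
  refine ENNReal.toReal_mono (measure_ne_top _ _) ((VectorMeasure.variation_map_le univ).trans ?_)
  rw [Measure.map_apply measurable_reflectMod MeasurableSet.univ, preimage_univ]

theorem totalVar_le_wNorm (hF : IsBVCircle F) {c : ℤ → ℂ} (hc : IsFourierStieltjesSeries c hF)
    {φ : ℝ → ℂ} (h : φ ∈ W) (hφ : Extends φ c) : totalVar F ≤ wNorm φ := by
  obtain ⟨μ, hμ⟩ := h
  refine le_csInf ⟨_, μ, hμ, rfl⟩ ?_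
  rintro _ ⟨ν, hν, rfl⟩
  exact totalVar_le hF hc hν hφ

theorem wNorm_phi₀ (hF : IsBVCircle F) {c : ℤ → ℂ} (hc : IsFourierStieltjesSeries c hF) :
    wNorm (phi₀ hF) = totalVar F := by
  refine le_antisymm ?_ (totalVar_le_wNorm hF hc ⟨_, represents_phi₀ hF⟩ (phi₀_extends hF hc))
  have hmem : (((dStieltjes hF).map fun t => -t).variation univ).toReal ∈
      {r : ℝ | ∃ μ, Represents μ (phi₀ hF) ∧ r = (μ.variation univ).toReal} :=
    ⟨_, represents_phi₀ hF, rfl⟩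
  refine (csInf_le ⟨0, ?_⟩ hmem).trans ?_
  · rintro _ ⟨ν, -, rfl⟩
    exact ENNReal.toReal_nonneg
  · rw [totalVar_eq hF]
    refine ENNReal.toReal_mono (measure_ne_top _ _) ((VectorMeasure.variation_map_le univ).trans ?_)
    rw [Measure.map_apply measurable_neg MeasurableSet.univ, preimage_univ]

/-! ### Fourier series, positive extensions, entire extensions. -/

/-- Uniqueness of coefficients in a form serving both Lebesgue densities (Fourier series) and
positive measures with density `1`. -/
theorem dStieltjes_eq_withDensityᵥ (hF : IsBVCircle F) {c : ℤ → ℂ}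
    (hc : IsFourierStieltjesSeries c hF) {m : Measure ℝ} {h : ℝ → ℂ} (hh : Integrable h m)
    (hm : ∀ᵐ t ∂m, t ∈ Ico (-π) π)
    (hk : ∀ k : ℤ, c k = ∫ t : ℝ, Complex.exp (-(Complex.I * k * t)) * h t ∂m) :
    dStieltjes hF = m.withDensityᵥ h := by
  have := isFiniteMeasure_variation_withDensityᵥ hh
  refine eq_of_coeff_eq (dStieltjes_restrict hF) (withDensityᵥ_restrict hh measurableSet_Ico hm)
    fun k => ?_
  have hi := integrable_exp_neg_I (m.withDensityᵥ h).variation k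
  rw [← hc k, hk k, integral_withDensityᵥ hh (by exact_mod_cast hi)]

theorem integral_Ico_mem_W₀ {f : ℝ → ℂ} (hf : IntegrableOn f (Ico (-π) π)) :
    (fun x : ℝ => ∫ t in Ico (-π) π, Complex.exp (-(Complex.I * x * t)) * f t) ∈ W₀ := by
  refine ⟨fun y => (Ico (-π) π).indicator f (-y),
    ((integrable_indicator_iff measurableSet_Ico).2 hf).comp_neg, fun x => ?_⟩
  rw [← integral_neg_eq_self fun y : ℝ => Complex.exp (Complex.I * x * y) *
    (Ico (-π) π).indicator f (-y)]
  dsimp only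
  rw [← integral_indicator measurableSet_Ico]
  refine integral_congr_ae (Eventually.of_forall fun t => ?_)
  by_cases ht : t ∈ Ico (-π) π
  · simp [ht]
  · simp [ht]

/-- The preimage is covered by countably many reflected translates of `E`. -/
theorem null_preimage_reflectMod {E : Set ℝ} (h0 : volume E = 0) :
    volume (reflectMod ⁻¹' E) = 0 := by
  have hsub : reflectMod ⁻¹' E ⊆ ⋃ n : ℤ, (fun y : ℝ => (n : ℝ) * (2 * π) - y) ⁻¹' E := by
    intro y hy
    obtain ⟨n, hn⟩ := exists_reflectMod_eq y
    refine mem_iUnion.2 ⟨n, ?_⟩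
    have : (n : ℝ) * (2 * π) - y = reflectMod y := by rw [hn]; ring
    simpa only [mem_preimage, this] using hy
  refine measure_mono_null hsub (measure_iUnion_null fun n => ?_)
  exact (quasiMeasurePreserving_sub_left volume _).preimage_null h0

theorem isFourierSeries_iff (c : ℤ → ℂ) : IsFourierSeries c ↔ ∃ φ ∈ W₀, Extends φ c := by
  have h2 : (2 * π : ℂ) ≠ 0 := by exact_mod_cast Real.two_pi_pos.ne'
  constructor
  · rintro ⟨f, hf, hk⟩
    refine ⟨_, integral_Ico_mem_W₀ (hf.const_mul (1 / (2 * π : ℂ))), fun k => ?_⟩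
    rw [hk k, ← integral_const_mul]
    refine integral_congr_ae (Eventually.of_forall fun t => ?_)
    dsimp only
    push_cast
    ring
  · rintro ⟨φ, ⟨g, hg, hφ⟩, hk⟩
    have hfin := isFiniteMeasure_variation_withDensityᵥ hg
    set μ : ComplexMeasure ℝ := volume.withDensityᵥ g with hμ
    -- The wrapped measure is absolutely continuous on the period; its density plays the role of the
    -- periodization of `g`, with no series to sum.
    have hac : ∀ s, MeasurableSet s → volume.restrict (Ico (-π) π) s = 0 →
        μ.map reflectMod s = 0 := by
      intro s hs h0
      rw [Measure.restrict_apply hs] at h0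
      rw [← map_reflectMod_restrict, VectorMeasure.restrict_apply _ measurableSet_Ico hs,
        VectorMeasure.map_apply _ measurable_reflectMod (hs.inter measurableSet_Ico), hμ,
        withDensityᵥ_apply hg (measurable_reflectMod (hs.inter measurableSet_Ico))]
      exact setIntegral_measure_zero _ (null_preimage_reflectMod h0)
    obtain ⟨f, hf, e⟩ := exists_withDensityᵥ_eq hac
    refine ⟨fun t => 2 * π * f t, hf.const_mul _, fun k => ?_⟩
    have hfinf := isFiniteMeasure_variation_withDensityᵥ hf
    have h1 := integral_map_reflectMod μ k
    have hi := integrable_exp_neg_I ((volume.restrict (Ico (-π) π)).withDensityᵥ f).variation k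
    rw [e, integral_withDensityᵥ hf (by exact_mod_cast hi), fourierStieltjes, hμ,
      integral_withDensityᵥ hg (integrable_exp_I _ _), ← hφ, hk] at h1
    rw [← h1, ← integral_const_mul]
    refine integral_congr_ae (Eventually.of_forall fun t => ?_)
    dsimp only
    field_simp

theorem phi₀_mem_W₀ (hF : IsBVCircle F) {c : ℤ → ℂ} (hc : IsFourierStieltjesSeries c hF)
    (h : IsFourierSeries c) : phi₀ hF ∈ W₀ := by
  obtain ⟨f, hf, hk⟩ := h
  have hf' : IntegrableOn (fun t => 1 / (2 * π : ℂ) * f t) (Ico (-π) π) := hf.const_mul _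
  have e := dStieltjes_eq_withDensityᵥ hF hc hf' (ae_restrict_mem measurableSet_Ico) fun k => by
    rw [hk k, ← integral_const_mul]
    refine integral_congr_ae (Eventually.of_forall fun t => ?_)
    dsimp only
    ring
  rw [show phi₀ hF = _ from funext fun x => phi₀_eq_integral hF hf' e x]
  exact integral_Ico_mem_W₀ hf'

theorem isIncreasing_iff (hF : IsBVCircle F) {c : ℤ → ℂ} (hc : IsFourierStieltjesSeries c hF) :
    IsIncreasing F ↔ ∃ φ ∈ WPos, Extends φ c := by
  constructor
  · intro h
    obtain ⟨m, hm, e⟩ := exists_measure_of_isIncreasing hF h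
    refine ⟨phi₀ hF, ⟨m.map fun t => -t, inferInstance, fun x => ?_⟩, phi₀_extends hF hc⟩
    rw [phi₀_eq_integral hF (integrable_const _) e, integral_map measurable_neg.aemeasurable
      (by fun_prop)]
    refine integral_congr_ae (Eventually.of_forall fun t => ?_)
    simp
  · rintro ⟨φ, ⟨μ, hμ, hφ⟩, hk⟩
    refine isIncreasing_of_measure hF (dStieltjes_eq_withDensityᵥ hF hc (m := μ.map reflectMod)
      (integrable_const _) ?_ fun k => ?_)
    · exact (ae_map_iff measurable_reflectMod.aemeasurable measurableSet_Ico).2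
        (Eventually.of_forall reflectMod_mem)
    · rw [integral_map measurable_reflectMod.aemeasurable (by fun_prop), ← hk, hφ]
      refine integral_congr_ae (Eventually.of_forall fun t => ?_)
      dsimp only
      rw [exp_reflectMod, mul_one]
      norm_cast

theorem entire_extension_iff (hF : IsBVCircle F) {c : ℤ → ℂ} (hc : IsFourierStieltjesSeries c hF)
    (φ : ℝ → ℂ) :
    (φ ∈ W ∧ Extends φ c ∧ ∃ g : ℂ → ℂ, IsEntireOfExpType π g ∧ ∀ x : ℝ, g x = φ x) ↔
      ∃ l : ℂ, ∀ x : ℝ, φ x = phi₀ hF x + l * Real.sin (π * x) := by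
  obtain ⟨g₀, hg₀, hg₀'⟩ := exists_entire_phi₀ hF
  constructor
  · rintro ⟨⟨μ, hμ⟩, hk, g, hg, hgφ⟩
    obtain ⟨M, hM⟩ := hμ.bounded
    obtain ⟨M₀, hM₀⟩ := (represents_phi₀ hF).bounded
    obtain ⟨l, hl⟩ := exists_eq_mul_sin (M := M + M₀) (isEntireOfExpType_sub hg hg₀)
      (fun x => by
        rw [hgφ, hg₀']
        exact (norm_sub_le _ _).trans (add_le_add (hM x) (hM₀ x)))
      (fun k => by
        have h1 := hgφ k
        have h2 := hg₀' k
        rw [hk] at h1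
        rw [phi₀_extends hF hc] at h2
        rw [Complex.ofReal_intCast] at h1 h2
        rw [h1, h2, sub_self])
    refine ⟨l, fun x => ?_⟩
    have h := hl x
    rw [hgφ, hg₀'] at h
    rw [Complex.ofReal_sin, Complex.ofReal_mul, ← h]
    ring
  · rintro ⟨l, hl⟩
    refine ⟨?_, fun k => ?_, _, isEntireOfExpType_add_mul_sin hg₀ l, fun x => ?_⟩
    · rw [show φ = phi₀ hF + fun x : ℝ => l * Real.sin (π * x) from funext hl]
      exact add_mem_W ⟨_, represents_phi₀ hF⟩ (mul_sin_mem_W l)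
    · rw [hl, mul_comm π, Real.sin_int_mul_pi, Complex.ofReal_zero, mul_zero, add_zero,
        phi₀_extends hF hc]
    · rw [hl, hg₀', Complex.ofReal_sin, Complex.ofReal_mul]

end WienerSeries

theorem theorem1 (c : ℤ → ℂ) :
    -- Fourier–Stieltjes series
    ((∃ (F : ℝ → ℂ) (hF : WienerSeries.IsBVCircle F), WienerSeries.IsFourierStieltjesSeries c hF) ↔
      ∃ φ ∈ WienerSeries.W, WienerSeries.Extends φ c) ∧
    -- Fourier series
    (WienerSeries.IsFourierSeries c ↔ ∃ φ ∈ WienerSeries.W₀, WienerSeries.Extends φ c) ∧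
    ∀ (F : ℝ → ℂ) (hF : WienerSeries.IsBVCircle F), WienerSeries.IsFourierStieltjesSeries c hF →
      -- the total variation of `F` is the minimal norm of an extension
      IsLeast {r : ℝ | ∃ φ ∈ WienerSeries.W, WienerSeries.Extends φ c ∧ r = WienerSeries.wNorm φ}
        (WienerSeries.totalVar F) ∧
      -- the minimum is attained at `φ₀`, which is in `W₀` in the case of a Fourier series
      (WienerSeries.phi₀ hF ∈ WienerSeries.W ∧ WienerSeries.Extends (WienerSeries.phi₀ hF) c ∧
        WienerSeries.wNorm (WienerSeries.phi₀ hF) = WienerSeries.totalVar F) ∧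
      (WienerSeries.IsFourierSeries c → WienerSeries.phi₀ hF ∈ WienerSeries.W₀) ∧
      -- the extensions that are entire functions of exponential type at most `π`
      (∀ φ : ℝ → ℂ,
        (φ ∈ WienerSeries.W ∧ WienerSeries.Extends φ c ∧
          ∃ g : ℂ → ℂ, WienerSeries.IsEntireOfExpType Real.pi g ∧ ∀ x : ℝ, g x = φ x) ↔
        ∃ l : ℂ, ∀ x : ℝ, φ x = WienerSeries.phi₀ hF x + l * Real.sin (Real.pi * x)) ∧
      -- increasing `F` and positive definite extensions
      (WienerSeries.IsIncreasing F ↔ ∃ φ ∈ WienerSeries.WPos, WienerSeries.Extends φ c) := by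
  open WienerSeries in
  refine ⟨⟨?_, ?_⟩, isFourierSeries_iff c, fun F hF hc => ⟨⟨?_, ?_⟩, ?_, phi₀_mem_W₀ hF hc,
    entire_extension_iff hF hc, isIncreasing_iff hF hc⟩⟩
  · rintro ⟨F, hF, hc⟩
    exact ⟨_, ⟨_, represents_phi₀ hF⟩, phi₀_extends hF hc⟩
  · rintro ⟨φ, ⟨μ, hμ⟩, hk⟩
    have := hμ.isFiniteMeasure
    obtain ⟨F, hF, e⟩ := exists_dStieltjes_eq (μ.map reflectMod) (map_reflectMod_restrict μ)
    refine ⟨F, hF, fun k => ?_⟩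
    rw [e, integral_map_reflectMod, ← hμ.2, hk]
  · exact ⟨_, ⟨_, represents_phi₀ hF⟩, phi₀_extends hF hc, (wNorm_phi₀ hF hc).symm⟩
  · rintro _ ⟨φ, hφ, hk, rfl⟩
    exact totalVar_le_wNorm hF hc hφ hk
  · exact ⟨⟨_, represents_phi₀ hF⟩, phi₀_extends hF hc, wNorm_phi₀ hF hc⟩
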